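/- A chord diagram of order $n$ (an $n$-chord diagram) is an oriented circle with $2n$ distinct points paired into $n$ disjoint pairs, called chords, considered up to orientation-preserving diffeomorphism. Two chords intersect if their endpoints alternate around the circle. The $\mathfrak{sl}_2$ weight $\varphi(\mathcal D)\in\mathbb Z[x]$ of a chord diagram is defined by the Chmutov–Varchenko recursion: the weight of the empty diagram is $1$ (so the weight of the $1$-chord diagram is $x$), and for an $n$-chord diagram $\mathcal D$ with $n\ge 1$ and any chord $a$ of $\mathcal D$, $$\varphi(\mathcal D)=(x-k)\,\varphi(\mathcal D_a)+\sum_{\{i,j\}\subset I_a}\bigl(\varphi(\mathcal D^1_{i,j})-\varphi(\mathcal D^2_{i,j})\bigr).$$ Here $\mathcal D_a$ is $\mathcal D$ with the chord $a$ deleted; $I_a$ is the set of chords of $\mathcal D$ intersecting $a$, and $k=\#I_a$; the sum is over unordered pairs of distinct elements of $I_a$; for $i\in I_a$, $p_i$ denotes its endpoint on one fixed side of $a$ and $p_i^*$ its endpoint on the other side; and $\mathcal D^1_{i,j}$ (respectively $\mathcal D^2_{i,j}$) is obtained from $\mathcal D_a$ by replacing the chords $i,j$ by $(p_i,p_j)$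 and $(p_i^*,p_j^*)$ (respectively by $(p_i,p_j^*)$ and $(p_j,p_i^*)$). The chord $a$ may be chosen arbitrarily at every step of the recursion, and the statement below holds for all such choices. For an $n$-chord diagram $\mathcal D$ put $\varphi_{\mathfrak{sl}_2}(\mathcal D)(x)=2^n\,\varphi(\mathcal D)(x/2)$. For $n\ge 1$ let $\mathcal D_n=((i,n+i):1\le i\le n)$ be the $n$-chord diagram on the points $1,\dots,2n$ in which every two chords intersect, and let $D_n=\varphi(\mathcal D_n)$. Let $(g_{i,j})_{1\le j\le\lceil i/2\rceil}$ be the Seidel triangle, defined by $g_{1,1}=1$ and, for all $p\ge 1$, $g_{2p,j}=g_{2p-1,j}+g_{2p,j+1}$ for $1\le j\le p$ and $g_{2p+1,j}=g_{2p+1,j-1}+g_{2p,j}$ for $1\le j\le p+1$, where $g_{2p,p+1}=g_{2p+1,0}=0$. For $n\ge 0$ let $H_{2n+1}=g_{2n+2,1}$ be the median Genocchi numbers and $h_n=H_{2n+1}/2^n$ the normalized median Genocchi numbers. Then for every $n\ge 1$: the number $h_{n-1}$ is an integer, that is, $2^{n-1}$ divides $H_{2n-1}$; $$D_n\equiv(-1)^{n-1}h_{n-1}\,x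 \pmod{x^2};$$ and, equivalently, $$\varphi_{\mathfrak{sl}_2}(\mathcal D_n)\equiv(-1)^{n-1}H_{2n-1}\,x \pmod{x^2}.$$ -/

import Mathlib

open Polynomial

/-- A chord, recorded by its two endpoints `p < p*`.  The points of the oriented circle are
labelled by natural numbers, increasing along the orientation from a base point. -/
abbrev Chord : Type := ℕ × ℕ

/-- The chord with endpoints `p` and `q`, given in any order. -/
def mkChord (p q : ℕ) : Chord := (min p q, max p q)

/-- The finite set of chords `D` represents a chord diagram of order `n`: `n` chords with `2 n`
distinct endpoints.  Only the cyclic order of the endpoints is meaningful, so the labels are not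
required to be consecutive (and need not be renumbered when a chord is deleted). -/
structure IsChordDiagram (n : ℕ) (D : Finset Chord) : Prop where
  card_eq : D.card = n
  lt : ∀ c ∈ D, c.1 < c.2
  disjoint : ∀ c ∈ D, ∀ d ∈ D, c ≠ d →
    c.1 ≠ d.1 ∧ c.1 ≠ d.2 ∧ c.2 ≠ d.1 ∧ c.2 ≠ d.2

/-- The label `p` lies on the open arc going from the first to the second endpoint of `a`,
that is, on one fixed side of `a`. -/
def OnSide (a : Chord) (p : ℕ) : Prop := a.1 < p ∧ p < a.2

instance (a : Chord) (p : ℕ) : Decidable (OnSide a p) := by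
  unfold OnSide; infer_instance

/-- The chords `a` and `c` intersect: their endpoints alternate around the circle. -/
def Crosses (a c : Chord) : Prop :=
  (a.1 < c.1 ∧ c.1 < a.2 ∧ a.2 < c.2) ∨ (c.1 < a.1 ∧ a.1 < c.2 ∧ c.2 < a.2)

instance (a c : Chord) : Decidable (Crosses a c) := by
  unfold Crosses; infer_instance

/-- For a chord `c` crossing `a`, its endpoint on the chosen side of `a`. -/
def sideEnd (a c : Chord) : ℕ := if OnSide a c.1 then c.1 else c.2

/-- For a chord `c` crossing `a`, its endpoint on the other side of `a`. -/
def farEnd (a c : Chord) : ℕ := if OnSide a c.1 then c.2 else c.1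

/-- The set `I_a` of the chords of `D` that intersect `a`. -/
def crossing (D : Finset Chord) (a : Chord) : Finset Chord := D.filter (Crosses a)

/-- The pairs `{i, j}` of distinct chords crossing `a`, each listed once, in the order of the
first endpoints. -/
def crossingPairs (D : Finset Chord) (a : Chord) : Finset (Chord × Chord) :=
  (crossing D a ×ˢ crossing D a).filter fun q => q.1.1 < q.2.1

/-- Delete `a`, and replace the chords `i`, `j` by the chord joining their endpoints on one side
of `a` and the chord joining their endpoints on the other side of `a`. -/
def resolveOne (D : Finset Chord) (a i j : Chord) : Finset Chord :=
  insert (mkChord (sideEnd a i) (sideEnd a j))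
    (insert (mkChord (farEnd a i) (farEnd a j)) (((D.erase a).erase i).erase j))

/-- Delete `a`, and replace the chords `i`, `j` by the two chords that join the endpoint of one
of them on one side of `a` to the endpoint of the other one on the other side of `a`. -/
def resolveTwo (D : Finset Chord) (a i j : Chord) : Finset Chord :=
  insert (mkChord (sideEnd a i) (farEnd a j))
    (insert (mkChord (sideEnd a j) (farEnd a i)) (((D.erase a).erase i).erase j))

/-- A rule that selects a chord in every nonempty chord diagram. -/
def IsChordChoice (c : Finset Chord → Chord) : Prop :=
  ∀ (n : ℕ) (D : Finset Chord), IsChordDiagram (n + 1) D → c D ∈ D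

/-- The weight `φ(D)` of a chord diagram `D` of order `n`, computed by the Chmutov–Varchenko
recursion, with the chord `a` selected by `c` at every step.  The empty diagram has weight `1`,
so that the diagram with one chord has weight `x`. -/
noncomputable def weight (c : Finset Chord → Chord) : ℕ → Finset Chord → ℤ[X]
  | 0, _ => 1
  | n + 1, D =>
    (X - C ((crossing D (c D)).card : ℤ)) * weight c n (D.erase (c D)) +
      ∑ q ∈ crossingPairs D (c D),
        (weight c n (resolveOne D (c D) q.1 q.2) - weight c n (resolveTwo D (c D) q.1 q.2))

/-- The weight `φ_{sl₂}(D)(x) = 2 ^ n * φ(D)(x / 2)` of a chord diagram `D` of order `n`. -/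
noncomputable def sl2Weight (c : Finset Chord → Chord) (n : ℕ) (D : Finset Chord) : ℚ[X] :=
  C (2 ^ n : ℚ) * ((weight c n D).map (Int.castRingHom ℚ)).comp (C (1 / 2 : ℚ) * X)

/-- The diagram `((i, n + i) : 1 ≤ i ≤ n)`, in which every two chords intersect. -/
def completeDiagram (n : ℕ) : Finset Chord :=
  (Finset.Icc 1 n).image fun i => (i, n + i)

/-- The Seidel triangle `g_{i,j}`, `1 ≤ j ≤ ⌈i / 2⌉`, extended by `0`.  Its defining recurrences
are summed along the rows here: downwards in `j` from `g_{2p,p+1} = 0`, and upwards from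
`g_{2p+1,0} = 0`; see `seidel_even` and `seidel_odd`. -/
def seidel : ℕ → ℕ → ℕ
  | 0, _ => 0
  | 1, j => if j = 1 then 1 else 0
  | i + 2, j =>
    if 1 ≤ j ∧ j ≤ (i + 3) / 2 then
      if Even i then ∑ l ∈ Finset.Icc j ((i + 3) / 2), seidel (i + 1) l
      else ∑ l ∈ Finset.Icc 1 j, seidel (i + 1) l
    else 0

/-- `medianGenocchi n` is the median Genocchi number `H_{2n+1} = g_{2n+2,1}`. -/
def medianGenocchi (n : ℕ) : ℕ := seidel (2 * n + 2) 1

/-- The normalized median Genocchi number `h_n = H_{2n+1} / 2 ^ n`. -/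
def normalizedMedianGenocchi (n : ℕ) : ℕ := medianGenocchi n / 2 ^ n

/-! Helper facts: the definitions above have the expected properties. -/

theorem seidel_one_one : seidel 1 1 = 1 := by simp [seidel]

theorem seidel_even_top (p : ℕ) (hp : 1 ≤ p) : seidel (2 * p) (p + 1) = 0 := by
  obtain ⟨p, rfl⟩ := Nat.exists_eq_add_of_le' hp
  rw [show 2 * (p + 1) = 2 * p + 2 by ring, seidel, if_neg (by omega)]

theorem seidel_odd_zero (p : ℕ) (hp : 1 ≤ p) : seidel (2 * p + 1) 0 = 0 := by
  obtain ⟨p, rfl⟩ := Nat.exists_eq_add_of_le' hp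
  rw [show 2 * (p + 1) + 1 = (2 * p + 1) + 2 by ring, seidel, if_neg (by omega)]

theorem seidel_even (p j : ℕ) (hj : 1 ≤ j) (hjp : j ≤ p) :
    seidel (2 * p) j = seidel (2 * p - 1) j + seidel (2 * p) (j + 1) := by
  obtain ⟨p, rfl⟩ := Nat.exists_eq_add_of_le' (hj.trans hjp)
  have he : Even (2 * p) := even_two_mul p
  have hd : (2 * p + 3) / 2 = p + 1 := by omega
  rw [show 2 * (p + 1) = 2 * p + 2 by ring, show 2 * p + 2 - 1 = 2 * p + 1 by omega, seidel,
    seidel, if_pos (by omega), if_pos he, if_pos he, hd]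
  rw [← Finset.add_sum_Ioc_eq_sum_Icc hjp]
  congr 1
  split_ifs with h
  · exact Finset.sum_congr (by ext; simp) fun _ _ => rfl
  · rw [Finset.Ioc_eq_empty (by omega), Finset.sum_empty]

theorem seidel_odd (p j : ℕ) (hp : 1 ≤ p) (hj : 1 ≤ j) (hjp : j ≤ p + 1) :
    seidel (2 * p + 1) j = seidel (2 * p + 1) (j - 1) + seidel (2 * p) j := by
  obtain ⟨p, rfl⟩ := Nat.exists_eq_add_of_le' hp
  obtain ⟨j, rfl⟩ := Nat.exists_eq_add_of_le' hj
  have he : ¬ Even (2 * p + 1) := by simp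
  have hd : (2 * p + 1 + 3) / 2 = p + 2 := by omega
  rw [show 2 * (p + 1) + 1 = (2 * p + 1) + 2 by ring, show 2 * (p + 1) = 2 * p + 1 + 1 by ring,
    Nat.add_sub_cancel]
  conv_lhs => rw [seidel]
  rw [if_pos (by omega), if_neg he, Finset.sum_Icc_succ_top (by omega)]
  congr 1
  conv_rhs => rw [seidel]
  rw [if_neg he]
  split_ifs with h
  · rfl
  · rw [Finset.Icc_eq_empty (by omega), Finset.sum_empty]

theorem isChordDiagram_completeDiagram (n : ℕ) : IsChordDiagram n (completeDiagram n) where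
  card_eq := by
    rw [completeDiagram, Finset.card_image_of_injective _ fun i j h => (Prod.mk.inj h).1]
    simp
  lt := by
    simp only [completeDiagram, Finset.mem_image, Finset.mem_Icc]
    rintro _ ⟨i, hi, rfl⟩
    simp only
    omega
  disjoint := by
    simp only [completeDiagram, Finset.mem_image, Finset.mem_Icc]
    rintro _ ⟨i, hi, rfl⟩ _ ⟨j, hj, rfl⟩ h
    have : i ≠ j := fun e => h (by rw [e])
    simp only
    omega

theorem crosses_of_mem_completeDiagram (n : ℕ) (a : Chord) (ha : a ∈ completeDiagram n)
    (c : Chord) (hc : c ∈ completeDiagram n) (h : a ≠ c) : Crosses a c := by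
  simp only [completeDiagram, Finset.mem_image, Finset.mem_Icc] at ha hc
  obtain ⟨i, hi, rfl⟩ := ha
  obtain ⟨j, hj, rfl⟩ := hc
  have : i ≠ j := fun e => h (by rw [e])
  simp only [Crosses]
  omega

theorem exists_isChordChoice : ∃ c, IsChordChoice c := by
  classical
  refine ⟨fun D => if h : D.Nonempty then h.choose else (0, 0), fun n D hD => ?_⟩
  have h : D.Nonempty := Finset.card_pos.mp (by rw [hD.card_eq]; omega)
  simp only [dif_pos h]
  exact h.choose_spec

theorem IsChordDiagram.erase {n : ℕ} {D : Finset Chord} (hD : IsChordDiagram (n + 1) D)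
    {a : Chord} (ha : a ∈ D) : IsChordDiagram n (D.erase a) where
  card_eq := by rw [Finset.card_erase_of_mem ha, hD.card_eq]; rfl
  lt := fun c hc => hD.lt c (Finset.mem_of_mem_erase hc)
  disjoint := fun c hc d hd =>
    hD.disjoint c (Finset.mem_of_mem_erase hc) d (Finset.mem_of_mem_erase hd)

/-- Replacing two chords by two chords on the same four endpoints gives a chord diagram. -/
theorem IsChordDiagram.replace {n : ℕ} {D : Finset Chord} (hD : IsChordDiagram n D)
    {i j k l : Chord} (hi : i ∈ D) (hj : j ∈ D) (hij : i ≠ j) (hk : k.1 < k.2) (hl : l.1 < l.2)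
    (hkl : k.1 ≠ l.1 ∧ k.1 ≠ l.2 ∧ k.2 ≠ l.1 ∧ k.2 ≠ l.2)
    (hk1 : k.1 = i.1 ∨ k.1 = i.2 ∨ k.1 = j.1 ∨ k.1 = j.2)
    (hk2 : k.2 = i.1 ∨ k.2 = i.2 ∨ k.2 = j.1 ∨ k.2 = j.2)
    (hl1 : l.1 = i.1 ∨ l.1 = i.2 ∨ l.1 = j.1 ∨ l.1 = j.2)
    (hl2 : l.2 = i.1 ∨ l.2 = i.2 ∨ l.2 = j.1 ∨ l.2 = j.2) :
    IsChordDiagram n (insert k (insert l ((D.erase i).erase j))) := by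
  have key : ∀ d ∈ (D.erase i).erase j,
      (k.1 ≠ d.1 ∧ k.1 ≠ d.2 ∧ k.2 ≠ d.1 ∧ k.2 ≠ d.2) ∧
      (l.1 ≠ d.1 ∧ l.1 ≠ d.2 ∧ l.2 ≠ d.1 ∧ l.2 ≠ d.2) := by
    intro d hd
    simp only [Finset.mem_erase] at hd
    obtain ⟨a1, a2, a3, a4⟩ := hD.disjoint i hi d hd.2.2 (Ne.symm hd.2.1)
    obtain ⟨b1, b2, b3, b4⟩ := hD.disjoint j hj d hd.2.2 (Ne.symm hd.1)
    have aux : ∀ x, (x = i.1 ∨ x = i.2 ∨ x = j.1 ∨ x = j.2) → x ≠ d.1 ∧ x ≠ d.2 := by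
      rintro x (rfl | rfl | rfl | rfl)
      exacts [⟨a1, a2⟩, ⟨a3, a4⟩, ⟨b1, b2⟩, ⟨b3, b4⟩]
    exact ⟨⟨(aux _ hk1).1, (aux _ hk1).2, (aux _ hk2).1, (aux _ hk2).2⟩,
      ⟨(aux _ hl1).1, (aux _ hl1).2, (aux _ hl2).1, (aux _ hl2).2⟩⟩
  have hlD : l ∉ (D.erase i).erase j := fun h => (key l h).2.1 rfl
  have hkD : k ∉ insert l ((D.erase i).erase j) := by
    rw [Finset.mem_insert, not_or]
    exact ⟨fun h => hkl.1 (by rw [h]), fun h => (key k h).1.1 rfl⟩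
  have hj' : j ∈ D.erase i := Finset.mem_erase.mpr ⟨hij.symm, hj⟩
  refine ⟨?_, ?_, ?_⟩
  · have h2 : 2 ≤ D.card := by
      have := Finset.card_pos.mpr ⟨j, hj'⟩
      rw [Finset.card_erase_of_mem hi] at this
      omega
    rw [Finset.card_insert_of_notMem hkD, Finset.card_insert_of_notMem hlD,
      Finset.card_erase_of_mem hj', Finset.card_erase_of_mem hi, ← hD.card_eq]
    omega
  · intro c hc
    simp only [Finset.mem_insert] at hc
    rcases hc with rfl | rfl | hc
    · exact hk
    · exact hl
    · simp only [Finset.mem_erase] at hc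
      exact hD.lt c hc.2.2
  · intro c hc d hd hcd
    simp only [Finset.mem_insert] at hc hd
    rcases hc with rfl | rfl | hc <;> rcases hd with rfl | rfl | hd
    · exact absurd rfl hcd
    · exact hkl
    · exact (key d hd).1
    · exact ⟨hkl.1.symm, hkl.2.2.1.symm, hkl.2.1.symm, hkl.2.2.2.symm⟩
    · exact absurd rfl hcd
    · exact (key d hd).2
    · obtain ⟨h1, h2, h3, h4⟩ := (key c hc).1
      exact ⟨h1.symm, h3.symm, h2.symm, h4.symm⟩
    · obtain ⟨h1, h2, h3, h4⟩ := (key c hc).2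
      exact ⟨h1.symm, h3.symm, h2.symm, h4.symm⟩
    · simp only [Finset.mem_erase] at hc hd
      exact hD.disjoint c hc.2.2 d hd.2.2 hcd

theorem isChordDiagram_resolve {n : ℕ} {D : Finset Chord} (hD : IsChordDiagram (n + 1) D)
    {a : Chord} (ha : a ∈ D) {q : Chord × Chord} (hq : q ∈ crossingPairs D a) :
    IsChordDiagram n (resolveOne D a q.1 q.2) ∧ IsChordDiagram n (resolveTwo D a q.1 q.2) := by
  obtain ⟨i, j⟩ := q
  simp only [crossingPairs, crossing, Finset.mem_filter, Finset.mem_product] at hq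
  obtain ⟨⟨⟨hi, hai⟩, ⟨hj, haj⟩⟩, hlt⟩ := hq
  have hij : i ≠ j := fun e => by rw [e] at hlt; exact lt_irrefl _ hlt
  have hne : ∀ c, Crosses a c → c ≠ a := by
    rintro c hc rfl
    simp only [Crosses] at hc
    omega
  have hi' : i ∈ D.erase a := Finset.mem_erase.mpr ⟨hne i hai, hi⟩
  have hj' : j ∈ D.erase a := Finset.mem_erase.mpr ⟨hne j haj, hj⟩
  have hd := hD.disjoint i hi j hj hij
  have h1 := hD.lt i hi
  have h2 := hD.lt j hj
  have hse : ∀ c : Chord, (sideEnd a c = c.1 ∧ farEnd a c = c.2) ∨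
      (sideEnd a c = c.2 ∧ farEnd a c = c.1) := by
    intro c
    by_cases h : OnSide a c.1 <;> simp [sideEnd, farEnd, h]
  have hm : ∀ x y : ℕ, ((mkChord x y).1 = x ∧ (mkChord x y).2 = y ∧ x ≤ y) ∨
      ((mkChord x y).1 = y ∧ (mkChord x y).2 = x ∧ y ≤ x) := by
    intro x y
    simp only [mkChord]
    omega
  have main : ∀ x y z t : ℕ,
      (x = i.1 ∧ z = i.2 ∨ x = i.2 ∧ z = i.1) → (y = j.1 ∧ t = j.2 ∨ y = j.2 ∧ t = j.1) →
      IsChordDiagram n (insert (mkChord x y)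
        (insert (mkChord z t) (((D.erase a).erase i).erase j))) ∧
      IsChordDiagram n (insert (mkChord x y)
        (insert (mkChord t z) (((D.erase a).erase i).erase j))) := by
    intro x y z t hx hy
    have hc : mkChord t z = mkChord z t := by simp only [mkChord, min_comm, max_comm]
    rw [hc, and_self]
    generalize hk : mkChord x y = k
    generalize hl : mkChord z t = l
    have hk' := hm x y
    have hl' := hm z t
    rw [hk] at hk'
    rw [hl] at hl'
    clear hk hl hm hc
    apply (hD.erase ha).replace hi' hj' hij <;> clear hne hai haj <;> omega
  have ei := hse i
  have ej := hse j
  exact ⟨(main _ _ _ _ ei ej).1, (main _ _ _ _ ei (ej.symm.imp And.symm And.symm)).2⟩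

/-!
Attach to every endpoint of a chord diagram one of three operators `S 0, S 1, S 2` spanning a copy
of `𝔰𝔩₂` with Casimir `x`, label the two ends of a chord alike, multiply along the circle and sum
over all labellings. Summing `S t * M * S t` over `t` brings in the double commutators of `M` with
the `S t`; the bracket relations turn these into pairs of infinitesimal rotations acting on the
endpoints inside the arc. A chord with both ends inside the arc is invariant, so only the crossing
chords contribute, and contracting two Levi-Civita symbols turns each pair of them into the two
resolutions. Thus the sum satisfies the Chmutov–Varchenko recursion at every chord, and it is the
weight evaluated at `x`, whatever choices are made in the recursion.

For the complete diagram the sum is the image of `Ω ^ n` under multiplication, where `Ω` is the sum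
of the `S t ⊗ S t`. Realize the `S t` by the differential operators of spin `j` in one variable,
for which `x = j (j + 1)`, and let `u`, `v` be the two copies of the multiplication by this
variable. Modulo operators killing the vacuum vector `1`, left multiplication by `Ω` preserves the
span of the `(u - v) ^ k ∂ ^ k`, on which it is bidiagonal; this gives the weights as polynomials
in `j`. At `j → 0` their recursion is the one satisfied by the values of the functional
`f (X) + f (X + 1) ↦ f' (0)` on `X ^ i (X + 1) ^ j`, expanded in central factorials, and these
values form the Seidel triangle.
-/

section Rotation

open Function

/-- The Levi-Civita symbol: the sign of `(a, b, c)` as a permutation of `(0, 1, 2)`, and `0` if two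
of the indices agree.  The Vandermonde product of a permutation of `(0, 1, 2)` is `±2`. -/
def leviCivita (a b c : Fin 3) : ℤ := ((b : ℤ) - a) * ((c : ℤ) - a) * ((c : ℤ) - b) / 2

theorem leviCivita_swap : ∀ a b c, leviCivita a c b = -leviCivita a b c := by decide

theorem sum_leviCivita_mul : ∀ b c b' c', ∑ t, leviCivita t b c * leviCivita t b' c' =
    (if b = b' ∧ c = c' then 1 else 0) - if b = c' ∧ c = b' then 1 else 0 := by decide

variable {M : Type*} [AddCommGroup M]

/-- The infinitesimal rotation about the axis `t` of the label at the point `p`, acting on functions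
of a labelling of the points by the three axes: this is the adjoint action of `𝔰𝔬₃ ≅ 𝔰𝔩₂` on the
tensor factor at `p`. -/
def rotate (t : Fin 3) (p : ℕ) (w : (ℕ → Fin 3) → M) (ℓ : ℕ → Fin 3) : M :=
  ∑ c, leviCivita t (ℓ p) c • w (update ℓ p c)

theorem rotate_comm (s t : Fin 3) {p q : ℕ} (hpq : p ≠ q) (w : (ℕ → Fin 3) → M) :
    rotate s p (rotate t q w) = rotate t q (rotate s p w) := by
  funext ℓ
  simp only [rotate, Finset.smul_sum]
  rw [Finset.sum_comm]
  refine Finset.sum_congr rfl fun c _ => Finset.sum_congr rfl fun b _ => ?_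
  rw [update_of_ne hpq.symm, update_of_ne hpq, update_comm hpq, smul_comm]

theorem sum_rotate_rotate_self (p : ℕ) (w : (ℕ → Fin 3) → M) (ℓ : ℕ → Fin 3) :
    ∑ t, rotate t p (rotate t p w) ℓ = (-2 : ℤ) • w ℓ := by
  have contraction : ∀ b c, ∑ t, ∑ d, leviCivita t b d * leviCivita t d c =
      if c = b then -2 else 0 := by decide
  simp only [rotate, update_self, update_idem, Finset.smul_sum, smul_smul]
  calc ∑ t, ∑ d, ∑ c, (leviCivita t (ℓ p) d * leviCivita t d c) • w (update ℓ p c)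
      = ∑ c, (∑ t, ∑ d, leviCivita t (ℓ p) d * leviCivita t d c) • w (update ℓ p c) := by
        simp only [Finset.sum_smul]
        exact (Finset.sum_congr rfl fun t _ => Finset.sum_comm).trans Finset.sum_comm
    _ = (-2 : ℤ) • w ℓ := by simp [contraction]

theorem sum_rotate_rotate_of_ne {p q : ℕ} (hpq : p ≠ q) (w : (ℕ → Fin 3) → M) (ℓ : ℕ → Fin 3) :
    ∑ t, rotate t p (rotate t q w) ℓ =
      (if ℓ p = ℓ q then ∑ c, w (update (update ℓ p c) q c) else 0) -
        w (update (update ℓ p (ℓ q)) q (ℓ p)) := by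
  simp only [rotate, update_of_ne hpq.symm, Finset.smul_sum, smul_smul]
  calc ∑ t, ∑ b, ∑ c, (leviCivita t (ℓ p) b * leviCivita t (ℓ q) c) •
          w (update (update ℓ p b) q c)
      = ∑ b, ∑ c, (∑ t, leviCivita t (ℓ p) b * leviCivita t (ℓ q) c) •
          w (update (update ℓ p b) q c) := by
        simp only [Finset.sum_smul]
        rw [Finset.sum_comm]
        exact Finset.sum_congr rfl fun b _ => Finset.sum_comm
    _ = _ := by simp [sum_leviCivita_mul, sub_smul, ite_and, eq_comm]

end Rotation

section Words

open Function

variable {ι A : Type*} [Ring A]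

/-- The product of the elements of `S` that `ℓ` assigns to the points of the list `l`, in order. -/
def word (S : ι → A) (l : List ℕ) (ℓ : ℕ → ι) : A := (l.map fun p => S (ℓ p)).prod

theorem word_cons (S : ι → A) (p : ℕ) (l : List ℕ) (ℓ : ℕ → ι) :
    word S (p :: l) ℓ = S (ℓ p) * word S l ℓ := by
  simp [word]

theorem word_append (S : ι → A) (l m : List ℕ) (ℓ : ℕ → ι) :
    word S (l ++ m) ℓ = word S l ℓ * word S m ℓ := by
  simp [word]

theorem word_update_of_notMem (S : ι → A) {l : List ℕ} {p : ℕ} (hp : p ∉ l) (ℓ : ℕ → ι) (c : ι) :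
    word S l (update ℓ p c) = word S l ℓ := by
  rw [word, word]
  congr 1
  refine List.map_congr_left fun q hq => ?_
  rw [update_of_ne (ne_of_mem_of_not_mem hq hp)]

theorem rotate_mul_mul (t : Fin 3) {p : ℕ} {f g : (ℕ → Fin 3) → A}
    (hf : ∀ ℓ c, f (update ℓ p c) = f ℓ) (hg : ∀ ℓ c, g (update ℓ p c) = g ℓ)
    (w : (ℕ → Fin 3) → A) :
    rotate t p (fun ℓ => f ℓ * w ℓ * g ℓ) = fun ℓ => f ℓ * rotate t p w ℓ * g ℓ := by
  funext ℓ
  simp only [rotate, hf, hg, Finset.mul_sum, Finset.sum_mul, mul_smul_comm, smul_mul_assoc]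

theorem rotate_rotate_word_append (S : Fin 3 → A) (t : Fin 3) {p q : ℕ} {l m r : List ℕ}
    (hp : p ∉ l ∧ p ∉ r) (hq : q ∉ l ∧ q ∉ r) (ℓ : ℕ → Fin 3) :
    rotate t p (rotate t q (word S (l ++ (m ++ r)))) ℓ =
      word S l ℓ * rotate t p (rotate t q (word S m)) ℓ * word S r ℓ := by
  have factor : word S (l ++ (m ++ r)) = fun ℓ => word S l ℓ * word S m ℓ * word S r ℓ := by
    funext ℓ
    rw [word_append, word_append, mul_assoc]
  rw [factor, rotate_mul_mul t (word_update_of_notMem S hq.1) (word_update_of_notMem S hq.2),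
    rotate_mul_mul t (word_update_of_notMem S hp.1) (word_update_of_notMem S hp.2)]

theorem rotate_word_cons_self (S : Fin 3 → A) (t : Fin 3) {p : ℕ} {l : List ℕ} (hp : p ∉ l)
    (ℓ : ℕ → Fin 3) :
    rotate t p (word S (p :: l)) ℓ = (∑ c, leviCivita t (ℓ p) c • S c) * word S l ℓ := by
  simp only [rotate, word_cons, update_self, word_update_of_notMem S hp, Finset.sum_mul,
    smul_mul_assoc]

theorem rotate_word_cons_of_ne (S : Fin 3 → A) (t : Fin 3) {p q : ℕ} (hpq : p ≠ q) (l : List ℕ)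
    (ℓ : ℕ → Fin 3) :
    rotate t q (word S (p :: l)) ℓ = S (ℓ p) * rotate t q (word S l) ℓ := by
  simp only [rotate, word_cons, update_of_ne hpq, Finset.mul_sum, mul_smul_comm]

end Words

section SpinTriples

/-- Three elements of a complex algebra that satisfy the commutation relations of spin operators,
with scalar Casimir element `x`. -/
structure IsSpinTriple {A : Type*} [Ring A] [Algebra ℂ A] (S : Fin 3 → A) (x : ℂ) : Prop where
  lie_eq : ∀ a b, ⁅S a, S b⁆ = Complex.I • ∑ c, leviCivita a b c • S c
  casimir : ∑ t, S t * S t = x • 1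

variable {A : Type*} [Ring A] [Algebra ℂ A] {S : Fin 3 → A} {x : ℂ}

theorem IsSpinTriple.lie_word (hS : IsSpinTriple S x) (t : Fin 3) {l : List ℕ} (hl : l.Nodup)
    (ℓ : ℕ → Fin 3) :
    ⁅S t, word S l ℓ⁆ = Complex.I • ∑ p ∈ l.toFinset, rotate t p (word S l) ℓ := by
  induction l with
  | nil => simp [word, Ring.lie_def]
  | cons q l ih =>
    obtain ⟨hq, hl⟩ := List.nodup_cons.mp hl
    have leibniz : ⁅S t, S (ℓ q) * word S l ℓ⁆ =
        ⁅S t, S (ℓ q)⁆ * word S l ℓ + S (ℓ q) * ⁅S t, word S l ℓ⁆ := by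
      simp only [Ring.lie_def]
      noncomm_ring
    have rotate_tail : ∑ p ∈ l.toFinset, rotate t p (word S (q :: l)) ℓ =
        S (ℓ q) * ∑ p ∈ l.toFinset, rotate t p (word S l) ℓ := by
      rw [Finset.mul_sum]
      refine Finset.sum_congr rfl fun p hp => rotate_word_cons_of_ne S t ?_ l ℓ
      exact (ne_of_mem_of_not_mem (List.mem_toFinset.mp hp) hq).symm
    rw [word_cons, leibniz, ih hl, hS.lie_eq, List.toFinset_cons,
      Finset.sum_insert (by simpa using hq), rotate_tail, rotate_word_cons_self S t hq, smul_add,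
      smul_mul_assoc, mul_smul_comm]

theorem IsSpinTriple.lie_lie_word (hS : IsSpinTriple S x) (t : Fin 3) {l : List ℕ} (hl : l.Nodup)
    (ℓ : ℕ → Fin 3) :
    ⁅S t, ⁅S t, word S l ℓ⁆⁆ =
      -∑ p ∈ l.toFinset, ∑ q ∈ l.toFinset, rotate t p (rotate t q (word S l)) ℓ := by
  have lie_rotate (p : ℕ) : ⁅S t, rotate t p (word S l) ℓ⁆ =
      Complex.I • ∑ q ∈ l.toFinset, rotate t p (rotate t q (word S l)) ℓ := by
    calc ⁅S t, rotate t p (word S l) ℓ⁆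
        = ∑ c, leviCivita t (ℓ p) c • ⁅S t, word S l (Function.update ℓ p c)⁆ := by
          simp only [rotate, Ring.lie_def, Finset.mul_sum, Finset.sum_mul, mul_smul_comm,
            smul_mul_assoc, ← Finset.sum_sub_distrib, ← smul_sub]
      _ = _ := by
          simp only [hS.lie_word t hl, rotate.eq_1 t p, Finset.smul_sum]
          rw [Finset.sum_comm]
          simp only [smul_comm Complex.I]
  calc ⁅S t, ⁅S t, word S l ℓ⁆⁆
      = Complex.I • ∑ p ∈ l.toFinset, ⁅S t, rotate t p (word S l) ℓ⁆ := by
        rw [hS.lie_word t hl]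
        simp only [Ring.lie_def, mul_smul_comm, smul_mul_assoc, Finset.mul_sum, Finset.sum_mul,
          ← Finset.sum_sub_distrib, ← smul_sub]
    _ = _ := by
        simp only [lie_rotate, ← Finset.smul_sum, smul_smul, Complex.I_mul_I, neg_one_smul]

theorem IsSpinTriple.two_smul_sum_mul_word_mul (hS : IsSpinTriple S x) {l : List ℕ}
    (hl : l.Nodup) (ℓ : ℕ → Fin 3) :
    (2 : ℂ) • ∑ t, S t * word S l ℓ * S t = (2 * x) • word S l ℓ +
      ∑ p ∈ l.toFinset, ∑ q ∈ l.toFinset, ∑ t, rotate t p (rotate t q (word S l)) ℓ := by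
  set w := word S l ℓ
  have double_lie (t : Fin 3) : (2 : ℂ) • (S t * w * S t) =
      S t * S t * w + w * (S t * S t) - ⁅S t, ⁅S t, w⁆⁆ := by
    simp only [Ring.lie_def, two_smul]
    noncomm_ring
  have sum_sum_sum_comm :
      ∑ t, ∑ p ∈ l.toFinset, ∑ q ∈ l.toFinset, rotate t p (rotate t q (word S l)) ℓ =
        ∑ p ∈ l.toFinset, ∑ q ∈ l.toFinset, ∑ t, rotate t p (rotate t q (word S l)) ℓ := by
    rw [Finset.sum_comm]
    exact Finset.sum_congr rfl fun p _ => Finset.sum_comm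
  rw [Finset.smul_sum]
  simp only [double_lie, w, hS.lie_lie_word _ hl, sub_neg_eq_add]
  rw [Finset.sum_add_distrib, Finset.sum_add_distrib, ← Finset.sum_mul, ← Finset.mul_sum,
    hS.casimir, sum_sum_sum_comm, smul_one_mul, mul_smul_one, ← add_smul, two_mul]

end SpinTriples

section Labellings

open Function

/-- The endpoints of the chords of `D`. -/
def chordEnds (D : Finset Chord) : Finset ℕ := D.image Prod.fst ∪ D.image Prod.snd

theorem mem_chordEnds {D : Finset Chord} {p : ℕ} :
    p ∈ chordEnds D ↔ ∃ c ∈ D, p = c.1 ∨ p = c.2 := by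
  simp only [chordEnds, Finset.mem_union, Finset.mem_image, ← exists_or, ← and_or_left, eq_comm]

theorem fst_mem_chordEnds {D : Finset Chord} {c : Chord} (hc : c ∈ D) : c.1 ∈ chordEnds D :=
  mem_chordEnds.mpr ⟨c, hc, .inl rfl⟩

theorem snd_mem_chordEnds {D : Finset Chord} {c : Chord} (hc : c ∈ D) : c.2 ∈ chordEnds D :=
  mem_chordEnds.mpr ⟨c, hc, .inr rfl⟩

theorem chordEnds_insert (c : Chord) (D : Finset Chord) :
    chordEnds (insert c D) = insert c.1 (insert c.2 (chordEnds D)) := by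
  simp only [chordEnds, Finset.image_insert, Finset.insert_union, Finset.union_insert,
    Finset.insert_comm c.2]

theorem mkChord_comm (p q : ℕ) : mkChord p q = mkChord q p := by
  rw [mkChord, mkChord, min_comm, max_comm]

theorem mkChord_of_le {p q : ℕ} (h : p ≤ q) : mkChord p q = (p, q) := by
  rw [mkChord, min_eq_left h, max_eq_right h]

theorem mkChord_fst_snd {c : Chord} (hc : c.1 < c.2) : mkChord c.1 c.2 = c :=
  mkChord_of_le hc.le

theorem chordEnds_insert_mkChord (p q : ℕ) (D : Finset Chord) :
    chordEnds (insert (mkChord p q) D) = insert p (insert q (chordEnds D)) := by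
  wlog h : p ≤ q generalizing p q
  · rw [mkChord_comm, this q p (le_of_not_ge h), Finset.insert_comm]
  rw [mkChord_of_le h, chordEnds_insert]

variable {σ : Type*}

theorem update_pair_idem (ℓ : ℕ → σ) (p q : ℕ) (s t : σ) :
    update (update (update (update ℓ p s) q s) p t) q t = update (update ℓ p t) q t := by
  funext r
  simp only [update_apply]
  split_ifs <;> rfl

theorem update_pair_eq_self {ℓ : ℕ → σ} {p q : ℕ} {t : σ} (hp : ℓ p = t) (hq : ℓ q = t) :
    update (update ℓ p t) q t = ℓ := by
  rw [← hp, update_eq_self, hp, ← hq, update_eq_self]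

variable [Inhabited σ]

section Finite

variable [Finite σ]

theorem finite_setOf_labelling (D : Finset Chord) :
    {ℓ : ℕ → σ | (∀ p ∉ chordEnds D, ℓ p = default) ∧ ∀ c ∈ D, ℓ c.1 = ℓ c.2}.Finite := by
  refine Set.Finite.of_finite_image (f := fun ℓ (p : chordEnds D) => ℓ p) (Set.toFinite _) ?_
  intro ℓ hℓ m hm h
  funext p
  by_cases hp : p ∈ chordEnds D
  · exact congrFun h ⟨p, hp⟩
  · rw [hℓ.1 p hp, hm.1 p hp]

/-- The labellings of the endpoints of `D` by elements of `σ` that are constant on every chord,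
extended by a default value to all points. -/
noncomputable def labellings (D : Finset Chord) : Finset (ℕ → σ) :=
  (finite_setOf_labelling D).toFinset

theorem mem_labellings {D : Finset Chord} {ℓ : ℕ → σ} :
    ℓ ∈ labellings D ↔ (∀ p ∉ chordEnds D, ℓ p = default) ∧ ∀ c ∈ D, ℓ c.1 = ℓ c.2 := by
  simp [labellings]

theorem labellings_empty : labellings (σ := σ) ∅ = {fun _ => default} := by
  ext ℓ
  simp [mem_labellings, chordEnds, funext_iff]

theorem mem_labellings_insert_mkChord {R : Finset Chord} {p q : ℕ} {ℓ : ℕ → σ} :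
    ℓ ∈ labellings (insert (mkChord p q) R) ↔
      (∀ r ∉ insert p (insert q (chordEnds R)), ℓ r = default) ∧
        ℓ p = ℓ q ∧ ∀ c ∈ R, ℓ c.1 = ℓ c.2 := by
  have apply_ends : ℓ (mkChord p q).1 = ℓ (mkChord p q).2 ↔ ℓ p = ℓ q := by
    rcases le_total p q with h | h <;> simp [mkChord, h, eq_comm]
  rw [mem_labellings, chordEnds_insert_mkChord, Finset.forall_mem_insert, apply_ends]

end Finite

variable [Fintype σ]

theorem sum_labellings_insert_mkChord {M : Type*} [AddCommMonoid M] {R : Finset Chord} {p q : ℕ}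
    (hpq : p ≠ q) (hp : p ∉ chordEnds R) (hq : q ∉ chordEnds R) (f : (ℕ → σ) → M) :
    ∑ ℓ ∈ labellings (insert (mkChord p q) R), f ℓ =
      ∑ ℓ ∈ labellings R, ∑ t, f (update (update ℓ p t) q t) := by
  have update_off {ℓ : ℕ → σ} {s t : σ} {r : ℕ} (hr : r ∈ chordEnds R) :
      update (update ℓ p s) q t r = ℓ r := by
    rw [update_of_ne (ne_of_mem_of_not_mem hr hq), update_of_ne (ne_of_mem_of_not_mem hr hp)]
  have update_chord {ℓ : ℕ → σ} {s t : σ} {c : Chord} (hc : c ∈ R) (hℓ : ℓ c.1 = ℓ c.2) :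
      update (update ℓ p s) q t c.1 = update (update ℓ p s) q t c.2 := by
    rw [update_off (fst_mem_chordEnds hc), update_off (snd_mem_chordEnds hc), hℓ]
  rw [← Finset.sum_product']
  refine Finset.sum_nbij' (fun ℓ => (update (update ℓ p default) q default, ℓ p))
    (fun x => update (update x.1 p x.2) q x.2) ?_ ?_ ?_ ?_ ?_
  all_goals simp only [Finset.mem_product, Finset.mem_univ, and_true,
    mem_labellings_insert_mkChord]
  · rintro ℓ ⟨hℓ, -, hR⟩
    refine mem_labellings.mpr ⟨fun r hr => ?_, fun c hc => update_chord hc (hR c hc)⟩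
    by_cases hrp : r = p <;> by_cases hrq : r = q <;> simp_all [update_apply]
  · rintro ⟨ℓ, t⟩ hℓ
    obtain ⟨hℓ, hR⟩ := mem_labellings.mp hℓ
    refine ⟨fun r hr => ?_, by simp [hpq], fun c hc => update_chord hc (hR c hc)⟩
    simp only [Finset.mem_insert, not_or] at hr
    rw [update_of_ne hr.2.1, update_of_ne hr.1, hℓ r hr.2.2]
  · rintro ℓ ⟨-, hℓ, -⟩
    rw [update_pair_idem, update_pair_eq_self rfl hℓ.symm]
  · rintro ⟨ℓ, t⟩ hℓ
    have hdef := (mem_labellings.mp hℓ).1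
    rw [update_pair_idem, update_pair_eq_self (hdef p hp) (hdef q hq), update_of_ne hpq,
      update_self]
  · rintro ℓ ⟨-, hℓ, -⟩
    rw [update_pair_idem, update_pair_eq_self rfl hℓ.symm]

theorem sum_labellings_insert_insert_mkChord {M : Type*} [AddCommMonoid M] {R : Finset Chord}
    {p p' q q' : ℕ} (hnd : [p, p', q, q'].Nodup) (hR : ∀ r ∈ [p, p', q, q'], r ∉ chordEnds R)
    (f : (ℕ → σ) → M) :
    ∑ ℓ ∈ labellings (insert (mkChord p p') (insert (mkChord q q') R)), f ℓ =
      ∑ ℓ ∈ labellings R, ∑ s, ∑ t, f (update (update (update (update ℓ q s) q' s) p t) p' t) := by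
  simp only [List.nodup_cons, List.mem_cons, List.not_mem_nil, List.nodup_nil, not_or, or_false,
    not_false_eq_true, and_true] at hnd
  simp only [List.forall_mem_cons] at hR
  obtain ⟨⟨hpp', hpq, hpq'⟩, ⟨hp'q, hp'q'⟩, hqq'⟩ := hnd
  obtain ⟨hp, hp', hq, hq', -⟩ := hR
  rw [sum_labellings_insert_mkChord hpp' (by simp [chordEnds_insert_mkChord, *])
    (by simp [chordEnds_insert_mkChord, *]), sum_labellings_insert_mkChord hqq' hq hq']

variable {M : Type*} [AddCommGroup M]

theorem sum_labellings_rotate_add_rotate {R : Finset Chord} {p q : ℕ} (hpq : p ≠ q)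
    (hp : p ∉ chordEnds R) (hq : q ∉ chordEnds R) (t : Fin 3) (w : (ℕ → Fin 3) → M) :
    ∑ ℓ ∈ labellings (insert (mkChord p q) R), (rotate t p w ℓ + rotate t q w ℓ) = 0 := by
  rw [sum_labellings_insert_mkChord hpq hp hq]
  refine Finset.sum_eq_zero fun ℓ _ => ?_
  rw [Finset.sum_add_distrib]
  have update_fst (b c : Fin 3) : update (update (update ℓ p b) q b) p c =
      update (update ℓ p c) q b := by
    rw [update_comm hpq.symm, update_idem]
  simp only [rotate, update_self, update_of_ne hpq, update_idem, update_fst]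
  nth_rw 1 [Finset.sum_comm]
  simp only [← Finset.sum_add_distrib]
  refine Finset.sum_eq_zero fun b _ => Finset.sum_eq_zero fun c _ => ?_
  rw [leviCivita_swap, neg_smul, neg_add_cancel]

theorem sum_labellings_rotate_rotate {R : Finset Chord} {p p' q q' : ℕ}
    (hnd : [p, p', q, q'].Nodup) (hR : ∀ r ∈ [p, p', q, q'], r ∉ chordEnds R)
    (w : (ℕ → Fin 3) → M) :
    ∑ ℓ ∈ labellings (insert (mkChord p p') (insert (mkChord q q') R)),
        ∑ t, rotate t p (rotate t q w) ℓ =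
      ∑ ℓ ∈ labellings (insert (mkChord p q) (insert (mkChord p' q') R)), w ℓ -
        ∑ ℓ ∈ labellings (insert (mkChord p q') (insert (mkChord q p') R)), w ℓ := by
  rw [sum_labellings_insert_insert_mkChord hnd hR,
    sum_labellings_insert_insert_mkChord (by simp at hnd ⊢; tauto) (by simp at hR ⊢; tauto),
    sum_labellings_insert_insert_mkChord (by simp at hnd ⊢; tauto) (by simp at hR ⊢; tauto),
    ← Finset.sum_sub_distrib]
  refine Finset.sum_congr rfl fun ℓ _ => ?_
  simp only [List.nodup_cons, List.mem_cons, List.not_mem_nil, List.nodup_nil, not_or, or_false,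
    not_false_eq_true, and_true] at hnd
  obtain ⟨⟨hpp', hpq, _⟩, ⟨hp'q, hp'q'⟩, hqq'⟩ := hnd
  set m : Fin 3 → Fin 3 → ℕ → Fin 3 :=
    fun s t => update (update (update (update ℓ q s) q' s) p t) p' t
  have apply_p (s t : Fin 3) : m s t p = t := by simp [m, hpp']
  have apply_q (s t : Fin 3) : m s t q = s := by simp [m, Ne.symm hp'q, Ne.symm hpq, hqq']
  have contracted (s c : Fin 3) : update (update (m s s) p c) q c =
      update (update (update (update ℓ p' s) q' s) p c) q c := by
    funext r
    simp only [m, update_apply]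
    split_ifs <;> simp_all
  have swapped (s t : Fin 3) : update (update (m s t) p s) q t =
      update (update (update (update ℓ q t) p' t) p s) q' s := by
    funext r
    simp only [m, update_apply]
    split_ifs <;> simp_all
  change ∑ s, ∑ t, ∑ i, rotate i p (rotate i q w) (m s t) = _
  simp only [sum_rotate_rotate_of_ne hpq, Finset.sum_sub_distrib, apply_p, apply_q, swapped,
    Finset.sum_ite_eq', Finset.mem_univ, if_true, contracted]
  rw [Finset.sum_comm (f := fun s t =>
    w (update (update (update (update ℓ q t) p' t) p s) q' s))]

end Labellings

section ArcDecomposition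

theorem sort_union_of_lt {s t : Finset ℕ} (h : ∀ p ∈ s, ∀ q ∈ t, p < q) :
    (s ∪ t).sort = s.sort ++ t.sort := by
  have lt_of_mem_sort : ∀ p ∈ s.sort, ∀ q ∈ t.sort, p < q := by simpa using h
  have nodup : (s.sort ++ t.sort).Nodup := List.nodup_append.mpr
    ⟨s.sort_nodup _, t.sort_nodup _, fun p hp q hq => (lt_of_mem_sort p hp q hq).ne⟩
  rw [← s.sort_toFinset (· ≤ ·), ← t.sort_toFinset (· ≤ ·), ← List.toFinset_append,
    Finset.sort_toFinset, Finset.sort_toFinset]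
  exact (List.toFinset_sort (· ≤ ·) nodup).mpr (List.pairwise_append.mpr
    ⟨s.pairwise_sort _, t.pairwise_sort _, fun p hp q hq => (lt_of_mem_sort p hp q hq).le⟩)

variable {P : Finset ℕ} {a : Chord}

theorem sort_eq_append_onSide_append (ha : a.1 < a.2) (h1 : a.1 ∉ P) (h2 : a.2 ∉ P) :
    P.sort = (P.filter (· < a.1)).sort ++
      ((P.filter (OnSide a)).sort ++ (P.filter (a.2 < ·)).sort) := by
  have cover : P = P.filter (· < a.1) ∪ (P.filter (OnSide a) ∪ P.filter (a.2 < ·)) := by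
    ext p
    have : p ∈ P → p ≠ a.1 ∧ p ≠ a.2 := fun hp =>
      ⟨ne_of_mem_of_not_mem hp h1, ne_of_mem_of_not_mem hp h2⟩
    simp only [Finset.mem_union, Finset.mem_filter, OnSide, ← and_or_left]
    grind
  conv_lhs => rw [cover]
  rw [sort_union_of_lt, sort_union_of_lt] <;>
    simp only [Finset.mem_union, Finset.mem_filter, OnSide] <;> grind

theorem sort_insert_insert_eq_append_onSide_append (ha : a.1 < a.2) (h1 : a.1 ∉ P)
    (h2 : a.2 ∉ P) :
    (insert a.1 (insert a.2 P)).sort = (P.filter (· < a.1)).sort ++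
      (a.1 :: ((P.filter (OnSide a)).sort ++ (a.2 :: (P.filter (a.2 < ·)).sort))) := by
  have cover : insert a.1 (insert a.2 P) = P.filter (· < a.1) ∪ ({a.1} ∪ (P.filter (OnSide a) ∪
      ({a.2} ∪ P.filter (a.2 < ·)))) := by
    ext p
    have : p ∈ P → p ≠ a.1 ∧ p ≠ a.2 := fun hp =>
      ⟨ne_of_mem_of_not_mem hp h1, ne_of_mem_of_not_mem hp h2⟩
    simp only [Finset.mem_union, Finset.mem_filter, Finset.mem_insert, Finset.mem_singleton, OnSide]
    grind
  rw [cover, sort_union_of_lt, sort_union_of_lt, sort_union_of_lt, sort_union_of_lt,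
    Finset.sort_singleton, Finset.sort_singleton]
  · rfl
  all_goals
    simp only [Finset.mem_union, Finset.mem_filter, Finset.mem_singleton, OnSide]
    grind

end ArcDecomposition

section WordSums

open Function

variable {A : Type*} [Ring A]

theorem word_insert_pair (S : Fin 3 → A) {l m r : List ℕ} {p q : ℕ} (hpq : p ≠ q)
    (hp : p ∉ l ++ (m ++ r)) (hq : q ∉ l ++ (m ++ r)) (ℓ : ℕ → Fin 3) (t : Fin 3) :
    word S (l ++ (p :: (m ++ (q :: r)))) (update (update ℓ p t) q t) =
      word S l ℓ * (S t * word S m ℓ * S t) * word S r ℓ := by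
  simp only [List.mem_append, not_or] at hp hq
  simp only [word_append, word_cons, update_self, update_of_ne hpq, word_update_of_notMem S hp.1,
    word_update_of_notMem S hp.2.1, word_update_of_notMem S hp.2.2, word_update_of_notMem S hq.1,
    word_update_of_notMem S hq.2.1, word_update_of_notMem S hq.2.2, mul_assoc]

/-- The state sum of `D`: the sum over the labellings of the chords by the three indices of `S` of
the product of the elements of `S` read along the circle, starting at the base point. -/
noncomputable def wordSum (S : Fin 3 → A) (D : Finset Chord) : A :=
  ∑ ℓ ∈ labellings D, word S (chordEnds D).sort ℓ

/-- The state sum of `D` in which the Casimir operator `∑ t, rotate t p ∘ rotate t q` of the points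
`p` and `q` is applied to the words. -/
noncomputable def rotatedWordSum (S : Fin 3 → A) (D : Finset Chord) (p q : ℕ) : A :=
  ∑ ℓ ∈ labellings D, ∑ t, rotate t p (rotate t q (word S (chordEnds D).sort)) ℓ

variable [Algebra ℂ A] {S : Fin 3 → A} {x : ℂ}

theorem IsSpinTriple.two_smul_sum_word_insert_pair (hS : IsSpinTriple S x) {l m r : List ℕ}
    {p q : ℕ} (hpq : p ≠ q) (hp : p ∉ l ++ (m ++ r)) (hq : q ∉ l ++ (m ++ r))
    (hnd : (l ++ (m ++ r)).Nodup) (ℓ : ℕ → Fin 3) :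
    (2 : ℂ) • ∑ t, word S (l ++ (p :: (m ++ (q :: r)))) (update (update ℓ p t) q t) =
      (2 * x) • word S (l ++ (m ++ r)) ℓ +
        ∑ i ∈ m.toFinset, ∑ j ∈ m.toFinset, ∑ t,
          rotate t i (rotate t j (word S (l ++ (m ++ r)))) ℓ := by
  obtain ⟨-, hmr, hl⟩ := List.nodup_append'.mp hnd
  obtain ⟨hm, -, hr⟩ := List.nodup_append'.mp hmr
  have notMem_outer {i : ℕ} (hi : i ∈ m.toFinset) : i ∉ l ∧ i ∉ r := by
    rw [List.mem_toFinset] at hi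
    exact ⟨fun h => hl h (List.mem_append_left _ hi), fun h => hr hi h⟩
  have rotate_rotate_factor : ∑ i ∈ m.toFinset, ∑ j ∈ m.toFinset, ∑ t,
      rotate t i (rotate t j (word S (l ++ (m ++ r)))) ℓ =
        word S l ℓ * (∑ i ∈ m.toFinset, ∑ j ∈ m.toFinset, ∑ t,
          rotate t i (rotate t j (word S m)) ℓ) * word S r ℓ := by
    simp only [Finset.mul_sum, Finset.sum_mul]
    exact Finset.sum_congr rfl fun i hi => Finset.sum_congr rfl fun j hj => Finset.sum_congr rfl
      fun t _ => rotate_rotate_word_append S t (notMem_outer hi) (notMem_outer hj) ℓ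
  simp only [word_insert_pair S hpq hp hq]
  rw [← Finset.sum_mul, ← Finset.mul_sum, ← smul_mul_assoc, ← mul_smul_comm,
    hS.two_smul_sum_mul_word_mul hm, mul_add, add_mul, rotate_rotate_factor, mul_smul_comm,
    smul_mul_assoc, word_append, word_append, mul_assoc]

theorem IsSpinTriple.two_smul_wordSum_insert (hS : IsSpinTriple S x) {E : Finset Chord} {a : Chord}
    (ha : a.1 < a.2) (h1 : a.1 ∉ chordEnds E) (h2 : a.2 ∉ chordEnds E) :
    (2 : ℂ) • wordSum S (insert a E) = (2 * x) • wordSum S E +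
      ∑ p ∈ chordEnds E with OnSide a p, ∑ q ∈ chordEnds E with OnSide a q,
        rotatedWordSum S E p q := by
  have sort_E := sort_eq_append_onSide_append ha h1 h2
  have notMem_sort {p : ℕ} (hp : p ∉ chordEnds E) : p ∉ (chordEnds E).sort := by simpa using hp
  have sum_word (ℓ : ℕ → Fin 3) := hS.two_smul_sum_word_insert_pair ha.ne
    (sort_E ▸ notMem_sort h1) (sort_E ▸ notMem_sort h2)
    (sort_E ▸ (chordEnds E).sort_nodup (· ≤ ·)) ℓ
  rw [← sort_E, Finset.sort_toFinset] at sum_word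
  rw [wordSum, chordEnds_insert, sort_insert_insert_eq_append_onSide_append ha h1 h2,
    ← mkChord_fst_snd ha, sum_labellings_insert_mkChord ha.ne h1 h2, mkChord_fst_snd ha,
    wordSum, Finset.smul_sum, Finset.smul_sum]
  simp only [sum_word, rotatedWordSum, Finset.sum_add_distrib]
  congr 1
  rw [Finset.sum_comm]
  exact Finset.sum_congr rfl fun p _ => Finset.sum_comm

end WordSums

section Resolutions

theorem crosses_iff_onSide {a c : Chord} (ha : a.1 < a.2) (hc : c.1 < c.2)
    (hac : a.1 ≠ c.1 ∧ a.1 ≠ c.2 ∧ a.2 ≠ c.1 ∧ a.2 ≠ c.2) :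
    Crosses a c ↔ ¬(OnSide a c.1 ↔ OnSide a c.2) := by
  simp only [Crosses, OnSide]
  omega

theorem not_crosses_self {a : Chord} : ¬Crosses a a := by
  simp only [Crosses]
  omega

theorem crossing_erase_self (D : Finset Chord) (a : Chord) :
    crossing (D.erase a) a = crossing D a := by
  rw [crossing, Finset.filter_erase, ← crossing,
    Finset.erase_eq_of_notMem (by simp [crossing, not_crosses_self])]

theorem sideEnd_farEnd_cases (a c : Chord) :
    sideEnd a c = c.1 ∧ farEnd a c = c.2 ∨ sideEnd a c = c.2 ∧ farEnd a c = c.1 := by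
  by_cases h : OnSide a c.1 <;> simp [sideEnd, farEnd, h]

theorem mkChord_sideEnd_farEnd (a : Chord) {c : Chord} (hc : c.1 < c.2) :
    mkChord (sideEnd a c) (farEnd a c) = c := by
  rcases sideEnd_farEnd_cases a c with ⟨h1, h2⟩ | ⟨h1, h2⟩ <;> rw [h1, h2]
  · exact mkChord_fst_snd hc
  · rw [mkChord_comm, mkChord_fst_snd hc]

namespace IsChordDiagram

variable {n : ℕ} {D : Finset Chord}

theorem fst_injOn (hD : IsChordDiagram n D) : Set.InjOn Prod.fst (D : Set Chord) := by
  intro c hc d hd h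
  by_contra hcd
  exact (hD.disjoint c hc d hd hcd).1 h

theorem sum_chordEnds (hD : IsChordDiagram n D) {M : Type*} [AddCommMonoid M] (f : ℕ → M) :
    ∑ p ∈ chordEnds D, f p = ∑ c ∈ D, (f c.1 + f c.2) := by
  have snd_injOn : Set.InjOn Prod.snd (D : Set Chord) := by
    intro c hc d hd h
    by_contra hcd
    exact (hD.disjoint c hc d hd hcd).2.2.2 h
  have disjoint_image : Disjoint (D.image Prod.fst) (D.image Prod.snd) := by
    rw [Finset.disjoint_left]
    simp only [Finset.mem_image, not_exists, not_and]
    rintro _ ⟨c, hc, rfl⟩ d hd h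
    rcases eq_or_ne d c with rfl | hdc
    · exact (hD.lt d hd).ne h.symm
    · exact (hD.disjoint d hd c hc hdc).2.2.1 h
  rw [chordEnds, Finset.sum_union disjoint_image, Finset.sum_image hD.fst_injOn,
    Finset.sum_image snd_injOn, Finset.sum_add_distrib]

theorem notMem_chordEnds_erase (hD : IsChordDiagram n D) {c : Chord} (hc : c ∈ D) :
    c.1 ∉ chordEnds (D.erase c) ∧ c.2 ∉ chordEnds (D.erase c) := by
  simp only [mem_chordEnds, Finset.mem_erase]
  constructor
  all_goals
    rintro ⟨d, ⟨hdc, hd⟩, h⟩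
    have := hD.disjoint c hc d hd hdc.symm
    omega

-- A chord with both endpoints on the chosen side of `a` contributes `g c.1 + g c.2 = 0`.
theorem sum_onSide_eq_sum_crossing (hD : IsChordDiagram (n + 1) D) {a : Chord} (ha : a ∈ D)
    {M : Type*} [AddCommMonoid M] {g : ℕ → M} (hg : ∀ c ∈ D.erase a, g c.1 + g c.2 = 0) :
    ∑ p ∈ chordEnds (D.erase a) with OnSide a p, g p = ∑ c ∈ crossing D a, g (sideEnd a c) := by
  rw [← crossing_erase_self, crossing, Finset.sum_filter, Finset.sum_filter,
    (hD.erase ha).sum_chordEnds]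
  refine Finset.sum_congr rfl fun c hc => ?_
  obtain ⟨hca, hcD⟩ := Finset.mem_erase.mp hc
  have crosses_iff :=
    crosses_iff_onSide (hD.lt a ha) (hD.lt c hcD) (hD.disjoint a ha c hcD hca.symm)
  by_cases h1 : OnSide a c.1 <;> by_cases h2 : OnSide a c.2 <;>
    simp [crosses_iff, sideEnd, h1, h2, hg c hc]

theorem nodup_ends (hD : IsChordDiagram n D) (a : Chord) {d e : Chord} (hd : d ∈ D) (he : e ∈ D)
    (hde : d ≠ e) : [sideEnd a d, farEnd a d, sideEnd a e, farEnd a e].Nodup := by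
  have hd_lt := hD.lt d hd
  have he_lt := hD.lt e he
  have hdisj := hD.disjoint d hd e he hde
  have hd_ends := sideEnd_farEnd_cases a d
  have he_ends := sideEnd_farEnd_cases a e
  simp only [List.nodup_cons, List.mem_cons, List.not_mem_nil, List.nodup_nil, or_false,
    not_false_eq_true, and_true]
  omega

theorem ends_notMem_chordEnds (hD : IsChordDiagram n D) (a : Chord) {d e : Chord} (hd : d ∈ D)
    (he : e ∈ D) : ∀ r ∈ [sideEnd a d, farEnd a d, sideEnd a e, farEnd a e],
      r ∉ chordEnds ((D.erase d).erase e) := by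
  have mono {c : Chord} (hc : (D.erase d).erase e ⊆ D.erase c) :
      chordEnds ((D.erase d).erase e) ⊆ chordEnds (D.erase c) :=
    Finset.union_subset_union (Finset.image_subset_image hc) (Finset.image_subset_image hc)
  have hd_notMem := hD.notMem_chordEnds_erase hd
  have he_notMem := hD.notMem_chordEnds_erase he
  have := mono (Finset.erase_subset e (D.erase d))
  have := mono (Finset.erase_subset_erase e (Finset.erase_subset d D))
  rcases sideEnd_farEnd_cases a d with ⟨h1, h2⟩ | ⟨h1, h2⟩ <;>
    rcases sideEnd_farEnd_cases a e with ⟨h3, h4⟩ | ⟨h3, h4⟩ <;>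
    simp only [List.forall_mem_cons, h1, h2, h3, h4] <;> grind

end IsChordDiagram

theorem eq_insert_insert_erase_erase {D : Finset Chord} {d e : Chord} (a : Chord) (hd : d ∈ D)
    (he : e ∈ D) (hde : d ≠ e) (hd_lt : d.1 < d.2) (he_lt : e.1 < e.2) :
    D = insert (mkChord (sideEnd a d) (farEnd a d)) (insert (mkChord (sideEnd a e) (farEnd a e))
      ((D.erase d).erase e)) := by
  rw [mkChord_sideEnd_farEnd a hd_lt, mkChord_sideEnd_farEnd a he_lt,
    Finset.insert_erase (Finset.mem_erase.mpr ⟨hde.symm, he⟩), Finset.insert_erase hd]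

end Resolutions

section Recursion

theorem sum_sum_eq_sum_diag_add_two_nsmul {α M : Type*} [AddCommMonoid M] {s : Finset α}
    {κ : α → ℕ} (hκ : Set.InjOn κ (s : Set α)) {F : α → α → M} (hF : ∀ d e, F d e = F e d) :
    ∑ d ∈ s, ∑ e ∈ s, F d e =
      ∑ d ∈ s, F d d + 2 • ∑ q ∈ s ×ˢ s with κ q.1 < κ q.2, F q.1 q.2 := by
  classical
  have offDiag_lt : s.offDiag.filter (fun q => κ q.1 < κ q.2) =
      (s ×ˢ s).filter fun q => κ q.1 < κ q.2 := by
    ext q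
    simp only [Finset.mem_filter, Finset.mem_offDiag, Finset.mem_product]
    grind
  have sum_offDiag_not_lt : ∑ q ∈ s.offDiag with ¬κ q.1 < κ q.2, F q.1 q.2 =
      ∑ q ∈ s ×ˢ s with κ q.1 < κ q.2, F q.1 q.2 := by
    refine Finset.sum_nbij' Prod.swap Prod.swap ?_ ?_ (by simp) (by simp) fun q _ => hF _ _
    all_goals
      simp only [Finset.mem_filter, Finset.mem_offDiag, Finset.mem_product, Prod.forall,
        Prod.fst_swap, Prod.snd_swap, not_lt]
    · rintro d e ⟨⟨hd, he, hde⟩, hle⟩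
      exact ⟨⟨he, hd⟩, hle.lt_of_ne fun h => hde (hκ he hd h).symm⟩
    · rintro d e ⟨⟨hd, he⟩, hlt⟩
      exact ⟨⟨he, hd, fun h => hlt.ne (by rw [h])⟩, hlt.le⟩
  have sum_offDiag : ∑ q ∈ s.offDiag, F q.1 q.2 =
      2 • ∑ q ∈ s ×ˢ s with κ q.1 < κ q.2, F q.1 q.2 := by
    rw [← Finset.sum_filter_add_sum_filter_not s.offDiag fun q => κ q.1 < κ q.2, offDiag_lt,
      sum_offDiag_not_lt, two_nsmul]
  rw [← sum_offDiag, ← Finset.sum_diag s fun q => F q.1 q.2,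
    ← Finset.sum_union (Finset.disjoint_diag_offDiag s), Finset.diag_union_offDiag,
    Finset.sum_product']

section RotatedWordSum

variable {A : Type*} [Ring A] {n : ℕ} {D : Finset Chord}

theorem rotatedWordSum_comm (S : Fin 3 → A) (D : Finset Chord) (p q : ℕ) :
    rotatedWordSum S D p q = rotatedWordSum S D q p := by
  rcases eq_or_ne p q with rfl | hpq
  · rfl
  · simp only [rotatedWordSum, rotate_comm _ _ hpq]

theorem rotatedWordSum_self (S : Fin 3 → A) (D : Finset Chord) (p : ℕ) :
    rotatedWordSum S D p p = (-2 : ℤ) • wordSum S D := by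
  simp only [rotatedWordSum, sum_rotate_rotate_self, ← Finset.smul_sum, wordSum]

theorem IsChordDiagram.rotatedWordSum_add_eq_zero (hD : IsChordDiagram n D) (S : Fin 3 → A)
    {c : Chord} (hc : c ∈ D) (q : ℕ) :
    rotatedWordSum S D c.1 q + rotatedWordSum S D c.2 q = 0 := by
  obtain ⟨h1, h2⟩ := hD.notMem_chordEnds_erase hc
  have invariance := sum_labellings_rotate_add_rotate (M := A) (hD.lt c hc).ne h1 h2
  rw [mkChord_fst_snd (hD.lt c hc), Finset.insert_erase hc] at invariance
  simp only [rotatedWordSum, ← Finset.sum_add_distrib]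
  rw [Finset.sum_comm]
  exact Finset.sum_eq_zero fun t _ => invariance t _

theorem IsChordDiagram.rotatedWordSum_sideEnd (hD : IsChordDiagram (n + 1) D) (S : Fin 3 → A)
    {a d e : Chord} (ha : a ∈ D) (hd : d ∈ D.erase a) (he : e ∈ D.erase a) (hde : d ≠ e) :
    rotatedWordSum S (D.erase a) (sideEnd a d) (sideEnd a e) =
      wordSum S (resolveOne D a d e) - wordSum S (resolveTwo D a d e) := by
  have hE := hD.erase ha
  have E_eq := eq_insert_insert_erase_erase a hd he hde (hE.lt d hd) (hE.lt e he)
  have chordEnds_E := congrArg chordEnds E_eq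
  rw [chordEnds_insert_mkChord, chordEnds_insert_mkChord] at chordEnds_E
  have chordEnds_one : chordEnds (resolveOne D a d e) = chordEnds (D.erase a) := by
    rw [resolveOne, chordEnds_insert_mkChord, chordEnds_insert_mkChord, chordEnds_E]
    grind
  have chordEnds_two : chordEnds (resolveTwo D a d e) = chordEnds (D.erase a) := by
    rw [resolveTwo, chordEnds_insert_mkChord, chordEnds_insert_mkChord, chordEnds_E]
    grind
  rw [rotatedWordSum, wordSum, wordSum, chordEnds_one, chordEnds_two, resolveOne, resolveTwo,
    ← sum_labellings_rotate_rotate (hE.nodup_ends a hd he hde) (hE.ends_notMem_chordEnds a hd he),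
    ← E_eq]

theorem IsChordDiagram.sum_onSide_onSide_rotatedWordSum (hD : IsChordDiagram (n + 1) D)
    (S : Fin 3 → A) {a : Chord} (ha : a ∈ D) :
    ∑ p ∈ chordEnds (D.erase a) with OnSide a p, ∑ q ∈ chordEnds (D.erase a) with OnSide a q,
        rotatedWordSum S (D.erase a) p q =
      ∑ d ∈ crossing D a, ∑ e ∈ crossing D a,
        rotatedWordSum S (D.erase a) (sideEnd a d) (sideEnd a e) := by
  have cancel {c : Chord} (hc : c ∈ D.erase a) (q : ℕ) :=
    (hD.erase ha).rotatedWordSum_add_eq_zero S hc q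
  rw [hD.sum_onSide_eq_sum_crossing ha fun c hc => by
    rw [← Finset.sum_add_distrib]
    exact Finset.sum_eq_zero fun q _ => cancel hc q]
  refine Finset.sum_congr rfl fun d _ => hD.sum_onSide_eq_sum_crossing ha fun c hc => ?_
  rw [rotatedWordSum_comm, rotatedWordSum_comm _ _ _ c.2, cancel hc]

end RotatedWordSum

variable {A : Type*} [Ring A] [Algebra ℂ A] {S : Fin 3 → A} {x : ℂ} {n : ℕ} {D : Finset Chord}

theorem IsSpinTriple.wordSum_recursion (hS : IsSpinTriple S x) (hD : IsChordDiagram (n + 1) D)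
    {a : Chord} (ha : a ∈ D) :
    wordSum S D = (x - (crossing D a).card) • wordSum S (D.erase a) +
      ∑ q ∈ crossingPairs D a,
        (wordSum S (resolveOne D a q.1 q.2) - wordSum S (resolveTwo D a q.1 q.2)) := by
  have sum_pairs : ∑ q ∈ crossingPairs D a,
      rotatedWordSum S (D.erase a) (sideEnd a q.1) (sideEnd a q.2) =
        ∑ q ∈ crossingPairs D a,
          (wordSum S (resolveOne D a q.1 q.2) - wordSum S (resolveTwo D a q.1 q.2)) := by
    refine Finset.sum_congr rfl fun q hq => ?_
    simp only [crossingPairs, ← crossing_erase_self D a, Finset.mem_filter,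
      Finset.mem_product] at hq
    obtain ⟨⟨hd, he⟩, hlt⟩ := hq
    exact hD.rotatedWordSum_sideEnd S ha (Finset.filter_subset _ _ hd)
      (Finset.filter_subset _ _ he) fun h => hlt.ne (by rw [h])
  have fst_injOn : Set.InjOn Prod.fst (crossing D a : Set Chord) :=
    hD.fst_injOn.mono (Finset.coe_subset.mpr (Finset.filter_subset _ _))
  obtain ⟨h1, h2⟩ := hD.notMem_chordEnds_erase ha
  have two_smul_eq := hS.two_smul_wordSum_insert (hD.lt a ha) h1 h2
  rw [Finset.insert_erase ha, hD.sum_onSide_onSide_rotatedWordSum S ha,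
    sum_sum_eq_sum_diag_add_two_nsmul fst_injOn fun d e => rotatedWordSum_comm _ _ _ _,
    ← crossingPairs, sum_pairs] at two_smul_eq
  simp only [rotatedWordSum_self, Finset.sum_const] at two_smul_eq
  refine (smul_right_inj (two_ne_zero' ℂ)).mp ?_
  rw [two_smul_eq]
  module

theorem IsSpinTriple.wordSum_eq_weight (hS : IsSpinTriple S x) {c : Finset Chord → Chord}
    (hc : IsChordChoice c) (hD : IsChordDiagram n D) :
    wordSum S D = aeval x (weight c n D) • 1 := by
  induction n generalizing D with
  | zero =>
    rw [Finset.card_eq_zero.mp hD.card_eq, wordSum, labellings_empty]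
    simp [chordEnds, word, weight]
  | succ n ih =>
    rw [hS.wordSum_recursion hD (hc n D hD), ih (hD.erase (hc n D hD)),
      Finset.sum_congr rfl fun q hq => by
        rw [ih (isChordDiagram_resolve hD (hc n D hD) hq).1,
          ih (isChordDiagram_resolve hD (hc n D hD) hq).2, ← sub_smul],
      ← Finset.sum_smul, smul_smul, ← add_smul]
    simp [weight]

end Recursion

section CompleteDiagram

open scoped TensorProduct

variable {A : Type*} [Ring A] [Algebra ℂ A]

/-- The invariant tensor of a family of three operators. -/
noncomputable def casimirTensor (S : Fin 3 → A) : A ⊗[ℂ] A := ∑ t, S t ⊗ₜ S t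

/-- The diagram of the chords `(i, N + i)` for `1 ≤ i ≤ n`. Fixing `N` while `n` varies allows
the chords of the complete diagram `shiftDiagram n n` to be added one at a time. -/
def shiftDiagram (N n : ℕ) : Finset Chord := (Finset.Icc 1 n).image fun i => (i, N + i)

theorem completeDiagram_eq_shiftDiagram (n : ℕ) : completeDiagram n = shiftDiagram n n := rfl

theorem shiftDiagram_succ (N n : ℕ) :
    shiftDiagram N (n + 1) = insert (mkChord (n + 1) (N + (n + 1))) (shiftDiagram N n) := by
  rw [shiftDiagram, ← Finset.insert_Icc_right_eq_Icc_add_one (by lia), Finset.image_insert,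
    mkChord_of_le (by lia), shiftDiagram]

theorem mem_chordEnds_shiftDiagram {N n p : ℕ} :
    p ∈ chordEnds (shiftDiagram N n) ↔ (1 ≤ p ∧ p ≤ n) ∨ (N + 1 ≤ p ∧ p ≤ N + n) := by
  simp only [chordEnds, shiftDiagram, Finset.image_image, Finset.mem_union, Finset.mem_image,
    Finset.mem_Icc, Function.comp_apply, exists_eq_right]
  refine or_congr_right ⟨by lia, fun h => ⟨p - N, by lia⟩⟩

theorem sort_chordEnds_completeDiagram (n : ℕ) :
    (chordEnds (completeDiagram n)).sort = List.range' 1 n ++ List.range' (n + 1) n := by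
  have chordEnds_eq : chordEnds (completeDiagram n) = (List.range' 1 (n + n)).toFinset := by
    ext p
    rw [completeDiagram_eq_shiftDiagram, mem_chordEnds_shiftDiagram, List.mem_toFinset,
      List.mem_range'_1]
    lia
  rw [chordEnds_eq, add_comm n 1, List.range'_append_1]
  exact (List.toFinset_sort (· ≤ ·) List.nodup_range').mpr List.pairwise_le_range'

theorem sum_labellings_shiftDiagram_word_tmul_word (S : Fin 3 → A) {N n : ℕ} (h : n ≤ N) :
    ∑ ℓ ∈ labellings (shiftDiagram N n),
      word S (List.range' 1 n) ℓ ⊗ₜ[ℂ] word S (List.range' (N + 1) n) ℓ = casimirTensor S ^ n := by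
  induction n with
  | zero => simp [shiftDiagram, labellings_empty, word, Algebra.TensorProduct.one_def]
  | succ n ih =>
    have notMem_left : n + 1 ∉ chordEnds (shiftDiagram N n) := by
      rw [mem_chordEnds_shiftDiagram]
      lia
    have notMem_right : N + (n + 1) ∉ chordEnds (shiftDiagram N n) := by
      rw [mem_chordEnds_shiftDiagram]
      lia
    have word_range'_succ {M t} {ℓ : ℕ → Fin 3} (hM : M = 0 ∨ M = N) :
        word S (List.range' (M + 1) (n + 1))
            (Function.update (Function.update ℓ (n + 1) t) (N + (n + 1)) t) =
          word S (List.range' (M + 1) n) ℓ * S t := by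
      rw [List.range'_1_concat, word_append, word_update_of_notMem, word_update_of_notMem,
        word_cons]
      · rcases hM with rfl | rfl <;> simp [word, Function.update_apply, add_comm, add_left_comm]
      all_goals
        rw [List.mem_range'_1]
        lia
    rw [shiftDiagram_succ, sum_labellings_insert_mkChord (by lia) notMem_left notMem_right,
      pow_succ, ← ih (by lia), casimirTensor, Finset.sum_mul_sum]
    refine Finset.sum_congr rfl fun ℓ _ => Finset.sum_congr rfl fun t _ => ?_
    rw [Algebra.TensorProduct.tmul_mul_tmul, ← word_range'_succ (.inr rfl),
      ← word_range'_succ (.inl rfl), zero_add]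

theorem wordSum_completeDiagram (S : Fin 3 → A) (n : ℕ) :
    wordSum S (completeDiagram n) = LinearMap.mul' ℂ A (casimirTensor S ^ n) := by
  rw [wordSum, sort_chordEnds_completeDiagram, completeDiagram_eq_shiftDiagram,
    ← sum_labellings_shiftDiagram_word_tmul_word S le_rfl, map_sum]
  exact Finset.sum_congr rfl fun ℓ _ => by rw [word_append, LinearMap.mul'_apply]

end CompleteDiagram

section LadderOperators

variable {A : Type*} [Ring A] [Algebra ℂ A]

theorem IsSpinTriple.of_lie_cyclic {S : Fin 3 → A} {x : ℂ} (h01 : ⁅S 0, S 1⁆ = Complex.I • S 2)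
    (h12 : ⁅S 1, S 2⁆ = Complex.I • S 0) (h20 : ⁅S 2, S 0⁆ = Complex.I • S 1)
    (hx : ∑ t, S t * S t = x • 1) : IsSpinTriple S x where
  lie_eq a b := by
    have lie_self (a : Fin 3) : ⁅S a, S a⁆ = 0 := by rw [Ring.lie_def, sub_self]
    have lie_swap (a b : Fin 3) : ⁅S b, S a⁆ = -⁅S a, S b⁆ := by
      rw [Ring.lie_def, Ring.lie_def, neg_sub]
    fin_cases a <;> fin_cases b <;>
      simp [leviCivita, Fin.sum_univ_three, h01, h12, h20, lie_self, lie_swap 0 1, lie_swap 1 2,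
        lie_swap 2 0]
  casimir := hx

/-- The Cartesian components of the spin with raising operator `R`, lowering operator `L` and
weight operator `Z`. -/
noncomputable def spinOfLadder (R L Z : A) : Fin 3 → A :=
  ![(1 / 2 : ℂ) • (R + L), -(Complex.I / 2) • (R - L), Z]

theorem sum_spinOfLadder_mul_spinOfLadder (R L Z R' L' Z' : A) :
    ∑ t, spinOfLadder R L Z t * spinOfLadder R' L' Z' t =
      Z * Z' + (1 / 2 : ℂ) • (R * L' + L * R') := by
  have neg_I_half_sq : -(Complex.I / 2) * -(Complex.I / 2) = -(1 / 4) := by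
    linear_combination (1 / 4) * Complex.I_mul_I
  simp only [spinOfLadder, Fin.sum_univ_three, Matrix.cons_val, smul_mul_smul_comm, neg_I_half_sq,
    add_mul, mul_add, sub_mul, mul_sub]
  module

theorem isSpinTriple_spinOfLadder {R L Z : A} {x : ℂ} (hRL : R * L - L * R = (2 : ℂ) • Z)
    (hZR : Z * R - R * Z = R) (hZL : Z * L - L * Z = -L)
    (hx : Z * Z + (1 / 2 : ℂ) • (R * L + L * R) = x • 1) :
    IsSpinTriple (spinOfLadder R L Z) x := by
  have I_mul_neg_I_half : Complex.I * -(Complex.I / 2) = 1 / 2 := by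
    linear_combination (-1 / 2) * Complex.I_mul_I
  refine .of_lie_cyclic ?_ ?_ ?_ ((sum_spinOfLadder_mul_spinOfLadder R L Z R L Z).trans hx)
  all_goals simp only [spinOfLadder, Matrix.cons_val, Ring.lie_def, smul_mul_assoc, mul_smul_comm,
    add_mul, mul_add, sub_mul, mul_sub, smul_smul, I_mul_neg_I_half]
  · linear_combination (norm := module) (Complex.I / 2) • hRL
  · linear_combination (norm := module) (Complex.I / 2) • hZR - (Complex.I / 2) • hZL
  · linear_combination (norm := module) (1 / 2 : ℂ) • hZR + (1 / 2 : ℂ) • hZL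

/-- The spin operators of spin `j` built from a Weyl pair `d * u = u * d + 1`, such as the
multiplication `u` by the variable and the differentiation `d` of polynomials. -/
noncomputable def weylSpin (j : ℂ) (u d : A) : Fin 3 → A :=
  spinOfLadder ((2 * j) • u - u * u * d) d (u * d - j • 1)

theorem isSpinTriple_weylSpin {u d : A} (h : d * u = u * d + 1) (j : ℂ) :
    IsSpinTriple (weylSpin j u d) (j * (j + 1)) := by
  have normal_order (w : A) : d * (u * w) = u * (d * w) + w := by
    rw [← mul_assoc, h, add_mul, one_mul, mul_assoc]
  apply isSpinTriple_spinOfLadder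
  all_goals
    simp only [sub_mul, mul_sub, smul_mul_assoc, mul_smul_comm, mul_assoc, h, normal_order,
      mul_add, mul_one, one_mul]
    module

theorem map_weylSpin {B : Type*} [Ring B] [Algebra ℂ B] (f : A →ₐ[ℂ] B) (j : ℂ) (u d : A)
    (t : Fin 3) : f (weylSpin j u d t) = weylSpin j (f u) (f d) t := by
  fin_cases t <;> simp [weylSpin, spinOfLadder]

end LadderOperators

section WeylPairs

section ScalarCommutator

variable {K R : Type*} [CommRing K] [Ring R] [Algebra K R] {a a' b : R} {c c' : K}

theorem mul_pow_succ_of_mul_eq_mul_add (h : a * b = b * a + c • 1) (n : ℕ) :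
    a * b ^ (n + 1) = b ^ (n + 1) * a + (c * (n + 1)) • b ^ n := by
  induction n with
  | zero => simp [h]
  | succ n ih =>
    rw [pow_succ, ← mul_assoc, ih, add_mul, mul_assoc, h, smul_mul_assoc, ← pow_succ, mul_add,
      mul_smul_comm, mul_one, ← mul_assoc, ← pow_succ]
    push_cast
    module

theorem mul_mul_pow_of_mul_eq_mul_add (h : a * b = b * a + c • 1) (n : ℕ) :
    b * (a * b ^ n) = b ^ (n + 1) * a + (c * n) • b ^ n := by
  cases n with
  | zero => simp
  | succ n =>
    rw [mul_pow_succ_of_mul_eq_mul_add h, mul_add, ← mul_assoc, ← pow_succ', mul_smul_comm,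
      ← pow_succ']
    push_cast
    rfl

theorem mul_mul_mul_mul_pow_of_mul_eq_mul_add (h : a * b = b * a + c • 1)
    (h' : a' * b = b * a' + c' • 1) (n : ℕ) :
    b * (b * (a * (a' * b ^ n))) = (b * a * b ^ (n + 1) - c • b ^ (n + 1)) * a' +
      (c' * n) • (b ^ (n + 1) * a) + (c * c' * (n * (n - 1))) • b ^ n := by
  have b_mul_a : b * a = a * b - c • 1 := by rw [h, add_sub_cancel_right]
  calc b * (b * (a * (a' * b ^ n)))
      = b * (a * (b * (a' * b ^ n))) - c • (b * (a' * b ^ n)) := by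
        rw [← mul_assoc b a, b_mul_a, sub_mul, mul_sub, smul_mul_assoc, one_mul, mul_smul_comm,
          mul_assoc a]
    _ = b * a * b ^ (n + 1) * a' + (c' * n) • (b * (a * b ^ n)) - c • (b * (a' * b ^ n)) := by
        simp only [mul_mul_pow_of_mul_eq_mul_add h', mul_add, mul_smul_comm, mul_assoc]
    _ = _ := by
        rw [mul_mul_pow_of_mul_eq_mul_add h, mul_mul_pow_of_mul_eq_mul_add h', sub_mul,
          smul_mul_assoc]
        module

end ScalarCommutator

variable {R : Type*} [Ring R] [Algebra ℂ R] {u d v e : R}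

theorem sum_weylSpin_mul_weylSpin (huv : v * u = u * v) (hdv : d * v = v * d) (j : ℂ) :
    ∑ t, weylSpin j u d t * weylSpin j v e t =
      (-(1 / 2) : ℂ) • ((u - v) * ((u - v) * (d * e))) - j • ((u - v) * d) +
        j • ((u - v) * e) + (j * j) • 1 := by
  have huv' (w : R) : v * (u * w) = u * (v * w) := by rw [← mul_assoc, huv, mul_assoc]
  have hdv' (w : R) : d * (v * w) = v * (d * w) := by rw [← mul_assoc, hdv, mul_assoc]
  rw [weylSpin, weylSpin, sum_spinOfLadder_mul_spinOfLadder]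
  simp only [mul_sub, sub_mul, smul_mul_assoc, mul_smul_comm, mul_assoc, hdv, huv', hdv', one_mul,
    mul_one]
  module

/-- Modulo the left ideal generated by `e`, the coupled spins preserve the span of the vectors
`(u - v) ^ k * d ^ k`. -/
theorem exists_sum_weylSpin_mul_pow_mul_pow (hdu : d * u = u * d + 1) (hev : e * v = v * e + 1)
    (huv : v * u = u * v) (hdv : d * v = v * d) (heu : e * u = u * e) (hde : d * e = e * d)
    (j : ℂ) (k : ℕ) :
    ∃ r, (∑ t, weylSpin j u d t * weylSpin j v e t) * ((u - v) ^ k * d ^ k) =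
      (k / 2 - j) • ((u - v) ^ (k + 1) * d ^ (k + 1)) +
        (k * (k - 1) / 2 - 2 * j * k + j ^ 2) • ((u - v) ^ k * d ^ k) + r * e := by
  rw [sum_weylSpin_mul_weylSpin huv hdv]
  have d_mul_sub : d * (u - v) = (u - v) * d + (1 : ℂ) • 1 := by
    rw [mul_sub, sub_mul, hdu, hdv, one_smul]
    abel
  have e_mul_sub : e * (u - v) = (u - v) * e + (-1 : ℂ) • 1 := by
    rw [mul_sub, sub_mul, hev, heu, neg_one_smul]
    abel
  generalize u - v = w at *
  have e_mul_d_pow : e * d ^ k = d ^ k * e := (Commute.pow_left hde k).symm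
  refine ⟨(-(1 / 2) : ℂ) • ((w * d * w ^ (k + 1) - w ^ (k + 1)) * d ^ k) +
    j • (w ^ (k + 1) * d ^ k), ?_⟩
  calc _ = ((-(1 / 2) : ℂ) • (w * (w * (d * (e * w ^ k)))) - j • (w * (d * w ^ k)) +
        j • (w * (e * w ^ k)) + (j * j) • w ^ k) * d ^ k := by
        simp only [add_mul, sub_mul, smul_mul_assoc, mul_assoc, one_mul]
    _ = _ := by
        rw [mul_mul_mul_mul_pow_of_mul_eq_mul_add d_mul_sub e_mul_sub,
          mul_mul_pow_of_mul_eq_mul_add d_mul_sub, mul_mul_pow_of_mul_eq_mul_add e_mul_sub,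
          pow_succ' d]
        simp only [add_mul, sub_mul, smul_mul_assoc, mul_assoc, e_mul_d_pow]
        module

end WeylPairs

section Moments

open scoped TensorProduct

/-- The polynomials in the spin that give the weights of the complete diagrams: up to the factor
`(-1) ^ k * k !`, `spinMoment n k` is the vacuum expectation of the `n`-th power of the invariant
tensor applied to the vector `(u - v) ^ k * d ^ k`. -/
noncomputable def spinMoment : ℕ → ℕ → ℂ[X]
  | 0, _ => 1
  | n + 1, k => (X - C (k / 2 : ℂ)) * C (k + 1 : ℂ) * spinMoment n (k + 1) +
      (X ^ 2 - C (2 * k : ℂ) * X + C (k * (k - 1) / 2 : ℂ)) * spinMoment n k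

variable {A : Type*} [Ring A] [Algebra ℂ A] {u d : A}

theorem casimirTensor_weylSpin (j : ℂ) (u d : A) :
    casimirTensor (weylSpin j u d) =
      ∑ t, weylSpin j (u ⊗ₜ[ℂ] (1 : A)) (d ⊗ₜ 1) t * weylSpin j ((1 : A) ⊗ₜ u) (1 ⊗ₜ d) t := by
  have left (t : Fin 3) :=
    map_weylSpin (Algebra.TensorProduct.includeLeft : A →ₐ[ℂ] A ⊗[ℂ] A) j u d t
  have right (t : Fin 3) :=
    map_weylSpin (Algebra.TensorProduct.includeRight : A →ₐ[ℂ] A ⊗[ℂ] A) j u d t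
  simp only [Algebra.TensorProduct.includeLeft_apply,
    Algebra.TensorProduct.includeRight_apply] at left right
  simp only [casimirTensor, ← left, ← right, Algebra.TensorProduct.tmul_mul_tmul, one_mul, mul_one]

theorem exists_casimirTensor_weylSpin_mul_pow_mul_pow (h : d * u = u * d + 1) (j : ℂ) (k : ℕ) :
    ∃ r, casimirTensor (weylSpin j u d) * ((u ⊗ₜ 1 - 1 ⊗ₜ u) ^ k * (d ⊗ₜ 1) ^ k) =
      (k / 2 - j) • ((u ⊗ₜ 1 - 1 ⊗ₜ u) ^ (k + 1) * (d ⊗ₜ 1) ^ (k + 1)) +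
        (k * (k - 1) / 2 - 2 * j * k + j ^ 2) • ((u ⊗ₜ 1 - 1 ⊗ₜ u) ^ k * (d ⊗ₜ 1) ^ k) +
          r * (1 ⊗ₜ d) := by
  rw [casimirTensor_weylSpin]
  apply exists_sum_weylSpin_mul_pow_mul_pow
  all_goals
    simp only [Algebra.TensorProduct.tmul_mul_tmul, one_mul, mul_one, h, TensorProduct.add_tmul,
      TensorProduct.tmul_add, Algebra.TensorProduct.one_def]

theorem mul'_mul_tmul (z : A ⊗[ℂ] A) (a b : A) :
    LinearMap.mul' ℂ A ((a ⊗ₜ 1) * z * (1 ⊗ₜ b)) = a * LinearMap.mul' ℂ A z * b := by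
  induction z with
  | zero => simp
  | add y z hy hz => simp only [mul_add, add_mul, map_add, hy, hz]
  | tmul y z => simp [mul_assoc]

theorem mul'_one_tmul_mul (z : A ⊗[ℂ] A) (a : A) :
    LinearMap.mul' ℂ A ((1 ⊗ₜ a) * z) = LinearMap.mul' ℂ A (z * (a ⊗ₜ 1)) := by
  induction z with
  | zero => simp
  | add y z hy hz => simp only [mul_add, add_mul, map_add, hy, hz]
  | tmul y z => simp [mul_assoc]

theorem mul'_sub_pow_mul_pow (h : d * u = u * d + 1) (k : ℕ) :
    LinearMap.mul' ℂ A ((u ⊗ₜ 1 - 1 ⊗ₜ u) ^ k * (d ⊗ₜ 1) ^ k) =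
      ((-1) ^ k * k.factorial : ℂ) • 1 := by
  induction k with
  | zero => simp [Algebra.TensorProduct.one_def]
  | succ k ih =>
    set w : A ⊗[ℂ] A := u ⊗ₜ 1 - 1 ⊗ₜ u with hw
    have u_mul_d : u * d = d * u + (-1 : ℂ) • 1 := by rw [h, neg_one_smul, add_neg_cancel_right]
    have commutator : (u ⊗ₜ 1 : A ⊗[ℂ] A) * (d ⊗ₜ 1) ^ (k + 1) =
        (d ⊗ₜ 1) ^ (k + 1) * (u ⊗ₜ 1) + (-1 * (k + 1) : ℂ) • (d ⊗ₜ 1) ^ k := by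
      refine mul_pow_succ_of_mul_eq_mul_add ?_ k
      rw [Algebra.TensorProduct.tmul_mul_tmul, Algebra.TensorProduct.tmul_mul_tmul, u_mul_d,
        mul_one, TensorProduct.add_tmul, Algebra.TensorProduct.one_def, TensorProduct.smul_tmul']
    have commute : Commute (u ⊗ₜ 1) (w ^ k) := by
      refine Commute.pow_right ((Commute.refl _).sub_right ?_) k
      simp [Commute, SemiconjBy]
    have ad : (u ⊗ₜ 1) * (w ^ k * (d ⊗ₜ 1) ^ (k + 1)) - w ^ k * (d ⊗ₜ 1) ^ (k + 1) * (u ⊗ₜ 1) =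
        (-1 * (k + 1) : ℂ) • (w ^ k * (d ⊗ₜ 1) ^ k) := by
      rw [← mul_assoc, commute.eq, mul_assoc, commutator, mul_add, mul_assoc, mul_smul_comm,
        add_sub_cancel_left]
    rw [pow_succ', mul_assoc, hw, sub_mul, map_sub, mul'_one_tmul_mul, ← map_sub, ← hw, ad,
      map_smul, ih, smul_smul, Nat.factorial_succ]
    push_cast
    congr 1
    ring

variable {M : Type*} [AddCommGroup M] [Module ℂ M] [Module A M] [IsScalarTower ℂ A M] {m : M}

theorem mul'_casimirTensor_weylSpin_pow_smul (h : d * u = u * d + 1) (hm : d • m = 0) (j : ℂ)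
    (n k : ℕ) :
    LinearMap.mul' ℂ A
        (casimirTensor (weylSpin j u d) ^ n * ((u ⊗ₜ 1 - 1 ⊗ₜ u) ^ k * (d ⊗ₜ 1) ^ k)) • m =
      ((-1) ^ k * k.factorial * (spinMoment n k).eval j) • m := by
  induction n generalizing k with
  | zero => rw [pow_zero, one_mul, mul'_sub_pow_mul_pow h]; simp [spinMoment]
  | succ n ih =>
    obtain ⟨r, hr⟩ := exists_casimirTensor_weylSpin_mul_pow_mul_pow h j k
    have annihilated :
        LinearMap.mul' ℂ A (casimirTensor (weylSpin j u d) ^ n * (r * (1 ⊗ₜ d))) • m = 0 := by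
      have := mul'_mul_tmul (casimirTensor (weylSpin j u d) ^ n * r) 1 d
      rw [← Algebra.TensorProduct.one_def, one_mul, one_mul] at this
      rw [← mul_assoc, this, mul_smul, hm, smul_zero]
    rw [pow_succ, mul_assoc, hr, mul_add, mul_add, map_add, map_add, add_smul, add_smul,
      annihilated, mul_smul_comm, mul_smul_comm, map_smul, map_smul, smul_assoc, smul_assoc, ih, ih,
      smul_smul, smul_smul, ← add_smul, add_zero, spinMoment]
    congr 1
    simp only [eval_add, eval_mul, eval_sub, eval_X, eval_C, eval_pow, Nat.factorial_succ]
    push_cast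
    ring

theorem weight_completeDiagram_comp {c : Finset Chord → Chord} (hc : IsChordChoice c) (n : ℕ) :
    ((weight c n (completeDiagram n)).map (Int.castRingHom ℂ)).comp (X * (X + 1)) =
      spinMoment n 0 := by
  refine Polynomial.funext fun j => ?_
  set u : Module.End ℂ ℂ[X] := LinearMap.mulLeft ℂ X
  set d : Module.End ℂ ℂ[X] := derivative
  have weyl : d * u = u * d + 1 := by
    refine LinearMap.ext fun f => ?_
    simp [u, d, derivative_mul, add_comm]
  have vacuum : d • (1 : ℂ[X]) = 0 := derivative_one
  have expectation := mul'_casimirTensor_weylSpin_pow_smul weyl vacuum j n 0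
  rw [pow_zero, pow_zero, mul_one, mul_one, ← wordSum_completeDiagram,
    (isSpinTriple_weylSpin weyl j).wordSum_eq_weight hc (isChordDiagram_completeDiagram n)]
    at expectation
  have eval_zero := congrArg (eval 0) expectation
  simpa [eval_comp, eval_map, aeval_def] using eval_zero

end Moments

section GenocchiFunctional

/-- The linear operator `f ↦ f (X) + f (X + 1)`. -/
noncomputable def shiftSum : ℚ[X] →ₗ[ℚ] ℚ[X] := LinearMap.id + taylor 1

theorem shiftSum_apply (f : ℚ[X]) : shiftSum f = f + f.comp (X + 1) := by
  rw [shiftSum, LinearMap.add_apply, LinearMap.id_apply, taylor_apply, C_1]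

theorem degree_sub_taylor_lt {R : Type*} [CommRing R] (r : R) {f : R[X]} (hf : f ≠ 0) :
    (f - taylor r f).degree < f.degree :=
  degree_sub_lt_left (degree_taylor f r).symm hf (leadingCoeff_taylor r f).symm

theorem shiftSum_injective : Function.Injective shiftSum := by
  rw [injective_iff_map_eq_zero]
  intro f hf
  by_contra f_ne_zero
  rw [shiftSum, LinearMap.add_apply, LinearMap.id_apply] at hf
  have sub_eq : f - taylor 1 f = C 2 * f := by
    rw [eq_neg_of_add_eq_zero_right hf, map_ofNat]
    ring
  have degree_lt := degree_sub_taylor_lt 1 f_ne_zero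
  rw [sub_eq, degree_C_mul two_ne_zero] at degree_lt
  exact lt_irrefl _ degree_lt

theorem map_degreeLT_shiftSum (n : ℕ) :
    (degreeLT ℚ n).map shiftSum = degreeLT ℚ n := by
  have maps_to : (degreeLT ℚ n).map shiftSum ≤ degreeLT ℚ n := by
    rintro _ ⟨f, hf, rfl⟩
    rw [SetLike.mem_coe, mem_degreeLT] at hf
    rw [mem_degreeLT, shiftSum, LinearMap.add_apply, LinearMap.id_apply]
    exact (degree_add_le _ _).trans_lt (max_lt hf (by rwa [degree_taylor]))
  exact Submodule.eq_of_le_of_finrank_eq maps_to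
    (LinearEquiv.finrank_eq (Submodule.equivMapOfInjective _ shiftSum_injective _)).symm

theorem shiftSum_surjective : Function.Surjective shiftSum := by
  intro f
  have mem : f ∈ degreeLT ℚ (f.natDegree + 1) :=
    mem_degreeLT.2 (degree_le_natDegree.trans_lt (by exact_mod_cast Nat.lt_succ_self _))
  rw [← map_degreeLT_shiftSum] at mem
  obtain ⟨g, -, hg⟩ := mem
  exact ⟨g, hg⟩

theorem shiftSum_bijective : Function.Bijective shiftSum :=
  ⟨shiftSum_injective, shiftSum_surjective⟩

/-- The linear functional that sends `f (X) + f (X + 1)` to `f' (0)`; its values on the powers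
of `X` are essentially the Genocchi numbers. -/
noncomputable def genocchiFunctional : ℚ[X] →ₗ[ℚ] ℚ :=
  lcoeff ℚ 1 ∘ₗ (LinearEquiv.ofBijective shiftSum shiftSum_bijective).symm.toLinearMap

theorem genocchiFunctional_shiftSum (f : ℚ[X]) :
    genocchiFunctional (shiftSum f) = f.coeff 1 := by
  rw [genocchiFunctional, LinearMap.comp_apply, LinearEquiv.coe_coe,
    LinearEquiv.ofBijective_symm_apply_apply, lcoeff_apply]

theorem genocchiFunctional_eq_zero_of_comp_eq {g : ℚ[X]} (hg : g.comp (-1 - X) = g) :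
    genocchiFunctional g = 0 := by
  obtain ⟨f, rfl⟩ := shiftSum_surjective g
  have even : f.comp (-X) = f := by
    apply shiftSum_injective
    rw [← hg, shiftSum_apply, shiftSum_apply, add_comp, comp_assoc, comp_assoc, add_comm]
    congr 2 <;> simp <;> ring
  have coeff_neg : (f.comp (-X)).coeff 1 = -f.coeff 1 := by
    rw [show (-X : ℚ[X]) = C (-1) * X by simp, comp_C_mul_X_coeff]
    ring
  rw [even] at coeff_neg
  rw [genocchiFunctional_shiftSum]
  linarith

end GenocchiFunctional

section GenocchiTable

/-- The values of the Genocchi functional on the products `X ^ i (X + 1) ^ j`: up to sign and a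
factor `2`, they are the entries of the Seidel triangle. -/
noncomputable def genocchiTable (i j : ℕ) : ℚ := genocchiFunctional (X ^ i * (X + 1) ^ j)

theorem genocchiTable_succ (i j : ℕ) :
    genocchiTable i (j + 1) = genocchiTable (i + 1) j + genocchiTable i j := by
  rw [genocchiTable, genocchiTable, genocchiTable, ← map_add]
  congr 1
  ring

theorem genocchiTable_self (i : ℕ) : genocchiTable i i = 0 := by
  refine genocchiFunctional_eq_zero_of_comp_eq ?_
  simp only [mul_comp, pow_comp, add_comp, X_comp, one_comp]
  rw [← mul_pow, ← mul_pow]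
  congr 1
  ring

theorem genocchiTable_zero_of_odd {n : ℕ} (hn : Odd n) :
    genocchiTable 0 n = if n = 1 then 1 / 2 else 0 := by
  have decomposition : (X : ℚ[X]) ^ 0 * (X + 1) ^ n =
      (1 / 2 : ℚ) • shiftSum (X ^ n) + (1 / 2 : ℚ) • ((X + 1) ^ n - X ^ n) := by
    rw [shiftSum_apply, pow_comp, X_comp, pow_zero, one_mul]
    module
  have symmetric : ((X + 1) ^ n - X ^ n : ℚ[X]).comp (-1 - X) = (X + 1) ^ n - X ^ n := by
    simp only [sub_comp, pow_comp, add_comp, X_comp, one_comp]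
    rw [show (-1 - X + 1 : ℚ[X]) = -X by ring, show (-1 - X : ℚ[X]) = -(X + 1) by ring,
      hn.neg_pow, hn.neg_pow]
    ring
  rw [genocchiTable, decomposition, map_add, map_smul, map_smul, genocchiFunctional_shiftSum,
    genocchiFunctional_eq_zero_of_comp_eq symmetric, coeff_X_pow]
  simp [eq_comm]

theorem seidel_odd_eq_genocchiTable_of_even {p : ℕ} (hp : 1 ≤ p)
    (even : ∀ i l, 1 ≤ l → i + l = p + 1 →
      (seidel (2 * p) l : ℚ) = 2 * (-1) ^ p * genocchiTable i (p + l))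
    {i l : ℕ} (hil : i + l = p + 1) :
    (seidel (2 * p + 1) l : ℚ) = 2 * (-1) ^ p * genocchiTable i (p + 1 + l) := by
  induction l generalizing i with
  | zero =>
    rw [seidel_odd_zero p hp, show i = p + 1 by omega, add_zero, genocchiTable_self]
    simp
  | succ l ih =>
    rw [seidel_odd p (l + 1) hp (by omega) (by omega), Nat.add_sub_cancel, Nat.cast_add,
      ih (i := i + 1) (by omega), even i (l + 1) (by omega) hil, ← add_assoc (p + 1) l 1,
      genocchiTable_succ, show p + (l + 1) = p + 1 + l by ring]
    ring

theorem seidel_even_eq_genocchiTable_of_odd {p : ℕ}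
    (odd : ∀ i l, i + l = p + 1 →
      (seidel (2 * p + 1) l : ℚ) = 2 * (-1) ^ p * genocchiTable i (p + 1 + l))
    {i l : ℕ} (hl : 1 ≤ l) (hil : i + l = p + 2) :
    (seidel (2 * (p + 1)) l : ℚ) = 2 * (-1) ^ (p + 1) * genocchiTable i (p + 1 + l) := by
  induction i generalizing l with
  | zero =>
    obtain rfl : l = p + 1 + 1 := by omega
    rw [seidel_even_top (p + 1) (by omega), genocchiTable_zero_of_odd ⟨p + 1, by ring⟩,
      if_neg (by omega)]
    simp
  | succ i ih =>
    rw [seidel_even (p + 1) l hl (by omega), Nat.cast_add, ih (l := l + 1) (by omega) (by omega),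
      show 2 * (p + 1) - 1 = 2 * p + 1 by omega, odd i l (by omega), ← add_assoc (p + 1) l 1,
      genocchiTable_succ]
    ring

theorem seidel_odd_eq_genocchiTable {p i l : ℕ} (hil : i + l = p + 1) :
    (seidel (2 * p + 1) l : ℚ) = 2 * (-1) ^ p * genocchiTable i (p + 1 + l) := by
  induction p generalizing i l with
  | zero =>
    obtain ⟨rfl, rfl⟩ | ⟨rfl, rfl⟩ : (i = 1 ∧ l = 0) ∨ (i = 0 ∧ l = 1) := by omega
    · simp [seidel, genocchiTable_self]
    · have := genocchiTable_succ 0 1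
      rw [genocchiTable_self, genocchiTable_zero_of_odd odd_one, if_pos rfl] at this
      norm_num [seidel_one_one, this]
  | succ p ih =>
    exact seidel_odd_eq_genocchiTable_of_even (by omega)
      (fun _ _ hl => seidel_even_eq_genocchiTable_of_odd (fun _ _ => ih) hl) hil

theorem medianGenocchi_eq_genocchiTable (n : ℕ) :
    (medianGenocchi n : ℚ) = 2 * (-1) ^ (n + 1) * genocchiTable (n + 1) (n + 2) :=
  seidel_even_eq_genocchiTable_of_odd (fun _ _ => seidel_odd_eq_genocchiTable) le_rfl rfl

end GenocchiTable

section CentralFactorials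

/-- The normalized central factorials in which the powers of `X (X + 1)` are expanded: up to sign,
`centralFactorial m` is the product of the `X + i` for `-m < i ≤ m`, divided by `m ! (m + 1) !`. -/
noncomputable def centralFactorial : ℕ → ℚ[X]
  | 0 => 1
  | m + 1 => C (1 / (((m : ℚ) + 1) * (m + 2))) * (C ((m : ℚ) * (m + 1)) - X * (X + 1)) *
      centralFactorial m

theorem mul_centralFactorial (m : ℕ) :
    X * (X + 1) * centralFactorial m = ((m : ℚ) * (m + 1)) • centralFactorial m -
      (((m : ℚ) + 1) * (m + 2)) • centralFactorial (m + 1) := by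
  have ne_zero : ((m : ℚ) + 1) * (m + 2) ≠ 0 := by positivity
  have cancel : C (((m : ℚ) + 1) * (m + 2)) * C (1 / (((m : ℚ) + 1) * (m + 2))) = 1 := by
    rw [← C_mul, mul_one_div_cancel ne_zero, C_1]
  rw [smul_eq_C_mul, smul_eq_C_mul, centralFactorial]
  linear_combination ((C ((m : ℚ) * (m + 1)) - X * (X + 1)) * centralFactorial m) * cancel

theorem sub_mul_centralFactorial_succ (m : ℕ) :
    (X - C ((m : ℚ) + 1)) * centralFactorial (m + 1) = C (1 / (((m : ℚ) + 1) * (m + 2))) *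
      (C (((m : ℚ) + 1) ^ 2) - X ^ 2) * ((X - C (m : ℚ)) * centralFactorial m) := by
  rw [centralFactorial]
  simp only [C_mul, C_add, C_1, C_pow]
  ring

theorem comp_sub_mul_centralFactorial (m : ℕ) :
    ((X - C (m : ℚ)) * centralFactorial m).comp (X + 1) =
      (X + C ((m : ℚ) + 1)) * centralFactorial m := by
  induction m with
  | zero => simp [centralFactorial]
  | succ m ih =>
    rw [Nat.cast_succ, sub_mul_centralFactorial_succ, mul_comp, ih, centralFactorial]
    simp only [mul_comp, sub_comp, C_comp, pow_comp, X_comp, C_mul, C_add, C_1, C_pow, add_comp,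
      one_comp]
    ring

theorem coeff_one_sub_mul_centralFactorial (m : ℕ) :
    ((X - C (m : ℚ)) * centralFactorial m).coeff 1 = 1 / ((m : ℚ) + 1) := by
  induction m with
  | zero => simp [centralFactorial]
  | succ m ih =>
    rw [Nat.cast_succ, sub_mul_centralFactorial_succ, mul_assoc, coeff_C_mul, sub_mul, coeff_sub,
      coeff_C_mul, ih, coeff_X_pow_mul', if_neg (by norm_num)]
    field_simp
    ring

theorem genocchiFunctional_mul_centralFactorial (m : ℕ) :
    genocchiFunctional ((2 * X + 1) * centralFactorial m) = 1 / ((m : ℚ) + 1) := by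
  rw [← coeff_one_sub_mul_centralFactorial, ← genocchiFunctional_shiftSum, shiftSum_apply,
    comp_sub_mul_centralFactorial]
  congr 1
  simp only [C_add, C_1]
  ring

end CentralFactorials

section MedianGenocchi

/-- A two-parameter family of integers whose first column consists of the normalized median
Genocchi numbers with alternating signs; the recursion is that of `spinMoment` at spin `0`. -/
def signedGenocchi : ℕ → ℕ → ℤ
  | 0, _ => 1
  | n + 1, m => (m + 1).choose 2 * signedGenocchi n m -
      (m + 2).choose 2 * signedGenocchi n (m + 1)

theorem cast_signedGenocchi_succ {K : Type*} [Field K] [CharZero K] (n m : ℕ) :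
    (signedGenocchi (n + 1) m : K) = (m + 1) * m / 2 * signedGenocchi n m -
      (m + 2) * (m + 1) / 2 * signedGenocchi n (m + 1) := by
  simp only [signedGenocchi, Int.cast_sub, Int.cast_mul, Int.cast_natCast, Nat.cast_choose_two]
  push_cast
  ring

theorem genocchiFunctional_pow_mul_centralFactorial (n m : ℕ) :
    genocchiFunctional ((2 * X + 1) * ((X * (X + 1)) ^ (n + 1) * centralFactorial m)) =
      -(2 ^ n * (signedGenocchi n m : ℚ)) := by
  induction n generalizing m with
  | zero =>
    rw [zero_add, pow_one, mul_centralFactorial, mul_sub, mul_smul_comm, mul_smul_comm, map_sub,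
      map_smul, map_smul, genocchiFunctional_mul_centralFactorial,
      genocchiFunctional_mul_centralFactorial, signedGenocchi, smul_eq_mul, smul_eq_mul]
    field_simp
    push_cast
    ring
  | succ n ih =>
    rw [pow_succ, mul_assoc, mul_centralFactorial, mul_sub, mul_sub, mul_smul_comm, mul_smul_comm,
      mul_smul_comm, mul_smul_comm, map_sub, map_smul, map_smul, ih, ih, cast_signedGenocchi_succ,
      smul_eq_mul, smul_eq_mul]
    ring

theorem two_mul_genocchiTable_succ (n : ℕ) :
    2 * genocchiTable (n + 1) (n + 2) = -(2 ^ n * (signedGenocchi n 0 : ℚ)) := by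
  have expansion : (2 * X + 1) * ((X * (X + 1)) ^ (n + 1) * centralFactorial 0) =
      (2 : ℚ) • (X ^ (n + 1) * (X + 1) ^ (n + 2)) - X ^ (n + 1) * (X + 1) ^ (n + 1) := by
    rw [centralFactorial, smul_eq_C_mul, map_ofNat, mul_pow]
    ring
  rw [← genocchiFunctional_pow_mul_centralFactorial, expansion, map_sub, map_smul,
    ← genocchiTable, ← genocchiTable, genocchiTable_self, sub_zero, smul_eq_mul]

theorem medianGenocchi_eq (n : ℕ) :
    (medianGenocchi n : ℤ) = 2 ^ n * ((-1) ^ n * signedGenocchi n 0) := by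
  have cast_eq : (medianGenocchi n : ℚ) = 2 ^ n * ((-1) ^ n * signedGenocchi n 0) := by
    rw [medianGenocchi_eq_genocchiTable, mul_right_comm, two_mul_genocchiTable_succ]
    ring
  exact_mod_cast cast_eq

theorem two_pow_mul_normalizedMedianGenocchi (n : ℕ) :
    2 ^ n * normalizedMedianGenocchi n = medianGenocchi n := by
  refine Nat.mul_div_cancel' (Int.natCast_dvd_natCast.1 ?_)
  rw [medianGenocchi_eq, Nat.cast_pow, Nat.cast_ofNat]
  exact dvd_mul_right _ _

theorem signedGenocchi_zero_right (n : ℕ) :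
    signedGenocchi n 0 = (-1) ^ n * normalizedMedianGenocchi n := by
  have normalized : (normalizedMedianGenocchi n : ℤ) = (-1) ^ n * signedGenocchi n 0 := by
    refine mul_left_cancel₀ (pow_ne_zero n two_ne_zero) ((medianGenocchi_eq n).symm.trans ?_).symm
    exact_mod_cast (two_pow_mul_normalizedMedianGenocchi n).symm
  rw [normalized, ← mul_assoc, ← mul_pow, neg_one_mul, neg_neg, one_pow, one_mul]

end MedianGenocchi

section LowestCoefficients

theorem eval_spinMoment_succ (n m : ℕ) :
    (spinMoment n (m + 1)).eval 0 = (signedGenocchi n m : ℂ) := by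
  induction n generalizing m with
  | zero => simp [spinMoment, signedGenocchi]
  | succ n ih =>
    rw [cast_signedGenocchi_succ, spinMoment]
    simp only [eval_add, eval_mul, eval_sub, eval_X, eval_C, eval_pow, ih]
    push_cast
    ring

theorem spinMoment_succ_zero (n : ℕ) :
    spinMoment (n + 1) 0 = X * (spinMoment n 1 + X * spinMoment n 0) := by
  simp only [spinMoment, Nat.cast_zero, zero_div, mul_zero, zero_mul, map_zero, zero_add, map_one,
    sub_zero, add_zero, mul_one]
  ring

theorem coeff_comp_mul_add_one_zero {R : Type*} [CommSemiring R] (p : R[X]) :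
    (p.comp (X * (X + 1))).coeff 0 = p.coeff 0 := by
  simp [coeff_zero_eq_eval_zero, eval_comp]

theorem coeff_comp_mul_add_one_one {R : Type*} [CommSemiring R] (p : R[X]) :
    (p.comp (X * (X + 1))).coeff 1 = p.coeff 1 := by
  have coeff_one (q : R[X]) : q.coeff 1 = (derivative q).eval 0 := by
    simp [← coeff_zero_eq_eval_zero, coeff_derivative]
  rw [coeff_one, coeff_one, derivative_comp]
  simp [eval_comp]

variable {c : Finset Chord → Chord}

theorem coeff_weight_completeDiagram_zero (hc : IsChordChoice c) (n : ℕ) :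
    (weight c (n + 1) (completeDiagram (n + 1))).coeff 0 = 0 := by
  have := coeff_comp_mul_add_one_zero
    ((weight c (n + 1) (completeDiagram (n + 1))).map (Int.castRingHom ℂ))
  rw [weight_completeDiagram_comp hc, spinMoment_succ_zero, coeff_X_mul_zero, coeff_map,
    eq_intCast] at this
  exact_mod_cast this.symm

theorem coeff_weight_completeDiagram_one (hc : IsChordChoice c) (n : ℕ) :
    (weight c (n + 1) (completeDiagram (n + 1))).coeff 1 =
      (-1) ^ n * normalizedMedianGenocchi n := by
  have := coeff_comp_mul_add_one_one
    ((weight c (n + 1) (completeDiagram (n + 1))).map (Int.castRingHom ℂ))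
  rw [weight_completeDiagram_comp hc, spinMoment_succ_zero, coeff_X_mul, coeff_add,
    coeff_X_mul_zero, add_zero, coeff_zero_eq_eval_zero, eval_spinMoment_succ, coeff_map,
    eq_intCast, Int.cast_inj, signedGenocchi_zero_right] at this
  exact this.symm

theorem coeff_sl2Weight (n k : ℕ) (D : Finset Chord) :
    (sl2Weight c n D).coeff k = 2 ^ n * ((weight c n D).coeff k * (1 / 2) ^ k) := by
  rw [sl2Weight, coeff_C_mul, comp_C_mul_X_coeff, coeff_map, eq_intCast]

theorem X_sq_dvd_sub_C_mul_X_iff {R : Type*} [CommRing R] {p : R[X]} {r : R} :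
    X ^ 2 ∣ p - C r * X ↔ p.coeff 0 = 0 ∧ p.coeff 1 = r := by
  rw [X_pow_dvd_iff, Nat.forall_lt_succ_right, Nat.forall_lt_succ_right]
  simp [sub_eq_zero]

end LowestCoefficients

theorem mainTheorem2 (c : Finset Chord → Chord) (hc : IsChordChoice c) (n : ℕ) (hn : 1 ≤ n) :
    2 ^ (n - 1) ∣ medianGenocchi (n - 1) ∧
    (X ^ 2 : ℤ[X]) ∣ weight c n (completeDiagram n) -
      (-1) ^ (n - 1) * C (normalizedMedianGenocchi (n - 1) : ℤ) * X ∧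
    (X ^ 2 : ℚ[X]) ∣ sl2Weight c n (completeDiagram n) -
      (-1) ^ (n - 1) * C (medianGenocchi (n - 1) : ℚ) * X := by
  obtain ⟨n, rfl⟩ := Nat.exists_eq_add_of_le' hn
  rw [Nat.add_sub_cancel]
  have sign {R : Type} [CommRing R] (r : R) : (-1) ^ n * C r = C ((-1) ^ n * r) := by simp
  have coeff_zero := coeff_weight_completeDiagram_zero hc n
  have coeff_one := coeff_weight_completeDiagram_one hc n
  rw [sign, sign, X_sq_dvd_sub_C_mul_X_iff, X_sq_dvd_sub_C_mul_X_iff, coeff_sl2Weight,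
    coeff_sl2Weight, coeff_zero, coeff_one, ← two_pow_mul_normalizedMedianGenocchi n]
  refine ⟨dvd_mul_right _ _, ⟨rfl, rfl⟩, by simp, ?_⟩
  push_cast
  ring
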